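/- **Setting.** Let $k\ge 1$, $\mathbf n=(n_1,\dots,n_k)$ with $n_i\ge 1$, and let $\mathcal E$ be a complex Hilbert space. Let $\mathbb F_{n}^+$ be the unital free semigroup on generators $g_1,\dots,g_n$ with neutral element $g_0$, and $\mathbf F_{\mathbf n}^+=\mathbb F_{n_1}^+\times\cdots\times\mathbb F_{n_k}^+$. For a Hilbert space $\mathcal H$, the *regular polyball* $\mathbf B_{\mathbf n}(\mathcal H)$ is the set of all $\mathbf X=(X_1,\dots,X_k)$, $X_i=(X_{i,1},\dots,X_{i,n_i})\in B(\mathcal H)^{n_i}$, such that the entries of $X_s$ commute with those of $X_t$ for $s\ne t$, $\|\sum_j X_{i,j}X_{i,j}^*\|<1$ for every $i$, and $\mathbf\Delta_{\mathbf X}(I):=(\mathrm{id}-\Phi_{X_1})\circ\cdots\circ(\mathrm{id}-\Phi_{X_k})(I)$ is positive and invertible, where $\Phi_{X_i}(Y)=\sum_j X_{i,j}YX_{i,j}^*$. Write $X_{i,\alpha}=X_{i,j_1}\cdots X_{i,j_p}$ for $\alpha=g_{j_1}\cdots g_{j_p}$ and $X_{i,g_0}=I$. A function $F$, assigning to every $\mathbf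 X\in\mathbf B_{\mathbf n}(\mathcal H)$, for every Hilbert space $\mathcal H$, an operator $F(\mathbf X)\in B(\mathcal E\otimes\mathcal H)$, is *free $k$-pluriharmonic with coefficients in $B(\mathcal E)$* if there are operators $A_{(\boldsymbol\alpha;\boldsymbol\beta)}\in B(\mathcal E)$ with $$F(\mathbf X)=\sum_{m_1\in\mathbb Z}\cdots\sum_{m_k\in\mathbb Z}\ \sum_{\substack{\alpha_i,\beta_i\in\mathbb F_{n_i}^+\\ |\alpha_i|=m_i^-,\ |\beta_i|=m_i^+}}A_{(\boldsymbol\alpha;\boldsymbol\beta)}\otimes X_{1,\alpha_1}\cdots X_{k,\alpha_k}X_{1,\beta_1}^*\cdots X_{k,\beta_k}^*,$$ where the iterated series converge in the operator norm for every $\mathcal H$ and every $\mathbf X\in\mathbf B_{\mathbf n}(\mathcal H)$; here $m^+=\max\{m,0\}$, $m^-=\max\{-m,0\}$, and $\sum_{m\in\mathbb Z}$ converges when $\sum_{m<0}$ and $\sum_{m\ge0}$ both do. $F$ is *positive* if $F(\mathbf X)\ge0$ for every $\mathcal H$ and every $\mathbf X\in\mathbf B_{\mathbf n}(\mathcal H)$.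 For $r\in[0,1)$ let $F_r$ be the function $\mathbf X\mapsto F(r\mathbf X)$. Words $\omega,\gamma\in\mathbb F_n^+$ are *right comparable* if $\omega=\sigma\gamma$ or $\gamma=\sigma\omega$ for some word $\sigma$. Put $c_r^+(\omega,\gamma)=\sigma$ if $\omega=\sigma\gamma$ and $c_r^+(\omega,\gamma)=g_0$ if $\omega$ is a proper right factor of $\gamma$; and $c_r^-(\omega,\gamma)=c_r^+(\gamma,\omega)$. For $\boldsymbol\omega,\boldsymbol\gamma\in\mathbf F_{\mathbf n}^+$ these notions are taken coordinatewise. A free $k$-pluriharmonic function $G$ with coefficients $B_{(\boldsymbol\alpha;\boldsymbol\beta)}$ has the associated kernel $\Gamma_G:\mathbf F_{\mathbf n}^+\times\mathbf F_{\mathbf n}^+\to B(\mathcal E)$, $$\Gamma_G(\boldsymbol\sigma,\boldsymbol\omega)=B_{(c_r^+(\boldsymbol\sigma,\boldsymbol\omega);\,c_r^-(\boldsymbol\sigma,\boldsymbol\omega))}\ \text{ if }\boldsymbol\sigma,\boldsymbol\omega\text{ are right comparable},\qquad \Gamma_G(\boldsymbol\sigma,\boldsymbol\omega)=0\ \text{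 otherwise.}$$ A kernel $K$ is *positive semi-definite* if $\sum_{i,j=1}^m\langle K(\boldsymbol\sigma^{(i)},\boldsymbol\sigma^{(j)})h_j,h_i\rangle\ge0$ for all $m$, $h_i\in\mathcal E$ and $\boldsymbol\sigma^{(i)}\in\mathbf F_{\mathbf n}^+$. Finally, let $\mathbf S=\{\mathbf S_{i,j}\}$ be the left creation operators on the tensor product $\bigotimes_{i=1}^kF^2(H_{n_i})$ of full Fock spaces, which has the orthonormal basis $e_{\boldsymbol\gamma}=e_{\gamma_1}\otimes\cdots\otimes e_{\gamma_k}$, $\boldsymbol\gamma\in\mathbf F_{\mathbf n}^+$: $\mathbf S_{i,j}e_{\boldsymbol\gamma}=e_{\boldsymbol\gamma'}$, where $\boldsymbol\gamma'$ arises from $\boldsymbol\gamma$ by replacing $\gamma_i$ with $g_j\gamma_i$. **Theorem.** Let $F$ be a free $k$-pluriharmonic function with coefficients in $B(\mathcal E)$. For every $r\in[0,1)$, the function $F_r$ is free $k$-pluriharmonic with uniquely determined coefficients, so that $\Gamma_{F_r}$ is well defined, and the following statements are equivalent: 1. $F$ is positive; 2. the kernel $\Gamma_{F_r}$ is positive semi-definite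 for every $r\in[0,1)$; 3. $F(r\mathbf S)\ge0$ for every $r\in[0,1)$. -/

import Mathlib

open scoped TensorProduct ComplexOrder Topology InnerProductSpace
open Filter

universe u v

namespace FreePolyball

noncomputable section

/-! ### The regular polyball -/

/-- The elements of the direct product of the unital free semigroups on `n 1, …, n k` generators:
a word `g_{j_1} ⋯ g_{j_p}` is the list `[j_1, …, j_p]`, and the neutral element is `[]`. -/
abbrev MultiWord {k : ℕ} (n : Fin k → ℕ) : Type := ∀ i : Fin k, List (Fin (n i))

/-- The `k`-tuples `X = (X_1, …, X_k)` of row tuples `X_i = (X_{i,1}, …, X_{i,n_i})` of bounded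
operators on `H`. -/
abbrev OpTuple {k : ℕ} (n : Fin k → ℕ) (H : Type v) [NormedAddCommGroup H]
    [InnerProductSpace ℂ H] : Type v :=
  ∀ i : Fin k, Fin (n i) → H →L[ℂ] H

section Operators

variable {H : Type v} [NormedAddCommGroup H] [InnerProductSpace ℂ H] [CompleteSpace H]

/-- The completely positive map `Φ_T (Y) = ∑ j, T_j Y T_j^*` of a row tuple `T`. -/
def Phi {d : ℕ} (T : Fin d → H →L[ℂ] H) : Module.End ℂ (H →L[ℂ] H) :=
  ∑ j, LinearMap.mulLeftRight ℂ (T j, ContinuousLinearMap.adjoint (T j))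

/-- The defect mapping `Δ_X = (id - Φ_{X_1}) ∘ ⋯ ∘ (id - Φ_{X_k})`. -/
def defectMap {k : ℕ} {n : Fin k → ℕ} (X : OpTuple n H) : Module.End ℂ (H →L[ℂ] H) :=
  (List.ofFn fun i => (1 : Module.End ℂ (H →L[ℂ] H)) - Phi (X i)).prod

variable (H) in
/-- The regular polyball on `H`: entries of different row tuples commute, every row tuple is a
strict row contraction, and `Δ_X (I)` is positive and invertible. -/
def polyball {k : ℕ} (n : Fin k → ℕ) : Set (OpTuple n H) :=
  {X | (∀ s t : Fin k, s ≠ t → ∀ a b, Commute (X s a) (X t b)) ∧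
    (∀ i, ‖∑ j, X i j * ContinuousLinearMap.adjoint (X i j)‖ < 1) ∧
    IsStrictlyPositive (defectMap X 1)}

/-- `T_α = T_{j_1} ⋯ T_{j_p}` for the word `α = g_{j_1} ⋯ g_{j_p}`. -/
def wordOp {d : ℕ} (T : Fin d → H →L[ℂ] H) (α : List (Fin d)) : H →L[ℂ] H :=
  (α.map T).prod

/-- The monomial `X_{1,α_1} ⋯ X_{k,α_k} X_{1,β_1}^* ⋯ X_{k,β_k}^*`. -/
def monomial {k : ℕ} {n : Fin k → ℕ} (X : OpTuple n H) (α β : MultiWord n) : H →L[ℂ] H :=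
  (List.ofFn fun i => wordOp (X i) (α i)).prod *
    (List.ofFn fun i => ContinuousLinearMap.adjoint (wordOp (X i) (β i))).prod

end Operators

/-! ### Hilbert tensor products -/

/-- The Hilbert space tensor product, i.e. the completion of the algebraic tensor product with
respect to `⟪x ⊗ y, x' ⊗ y'⟫ = ⟪x, x'⟫ ⟪y, y'⟫`. -/
abbrev HTensor (E : Type u) (H : Type v) [NormedAddCommGroup E] [InnerProductSpace ℂ E]
    [NormedAddCommGroup H] [InnerProductSpace ℂ H] : Type (max u v) :=
  UniformSpace.Completion (E ⊗[ℂ] H)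

/-- The bounded operator `A ⊗ T` on `E ⊗ H`. -/
def opTensor {E : Type u} {H : Type v} [NormedAddCommGroup E] [InnerProductSpace ℂ E]
    [NormedAddCommGroup H] [InnerProductSpace ℂ H] (A : E →L[ℂ] E) (T : H →L[ℂ] H) :
    HTensor E H →L[ℂ] HTensor E H :=
  (TensorProduct.mapL A T).completion

theorem opTensor_tmul {E : Type u} {H : Type v} [NormedAddCommGroup E] [InnerProductSpace ℂ E]
    [NormedAddCommGroup H] [InnerProductSpace ℂ H] (A : E →L[ℂ] E) (T : H →L[ℂ] H) (x : E)
    (y : H) : opTensor A T ((x ⊗ₜ[ℂ] y : E ⊗[ℂ] H) : HTensor E H) =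
      ((A x ⊗ₜ[ℂ] T y : E ⊗[ℂ] H) : HTensor E H) := by
  rw [opTensor, ContinuousLinearMap.completion_apply_coe, TensorProduct.mapL_tmul]

/-! ### Free `k`-pluriharmonic functions -/

/-- The pairs `(α, β)` with `|α_i| = m_i^-` and `|β_i| = m_i^+` for some integers `m_i`, that is,
with `α_i` or `β_i` empty for every `i`. -/
abbrev CoeffIndex {k : ℕ} (n : Fin k → ℕ) : Type :=
  {p : MultiWord n × MultiWord n // ∀ i, p.1 i = [] ∨ p.2 i = []}

/-- The index `(α, β)` of multidegree `m`, with `α_i`, `β_i` given letter by letter. -/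
def CoeffIndex.ofDegree {k : ℕ} {n : Fin k → ℕ} (m : Fin k → ℤ)
    (a : ∀ i, Fin (-(m i)).toNat → Fin (n i)) (b : ∀ i, Fin (m i).toNat → Fin (n i)) :
    CoeffIndex n :=
  ⟨(fun i => List.ofFn (a i), fun i => List.ofFn (b i)), fun i => by
    rcases le_total 0 (m i) with h | h
    · left
      apply List.eq_nil_of_length_eq_zero
      simp [h]
    · right
      apply List.eq_nil_of_length_eq_zero
      simp [h]⟩

/-- The series `∑_{m ∈ ℤ} g m` converges to `s`: both `∑_{m < 0} g m` and `∑_{m ≥ 0} g m`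
converge, and `s` is the sum of the two limits. -/
def HasBilateralSum {M : Type*} [AddCommMonoid M] [TopologicalSpace M] (g : ℤ → M) (s : M) :
    Prop :=
  ∃ s₁ s₂ : M,
    Tendsto (fun N : ℕ => ∑ j ∈ Finset.range N, g (-((j : ℤ) + 1))) atTop (𝓝 s₁) ∧
    Tendsto (fun N : ℕ => ∑ j ∈ Finset.range N, g (j : ℤ)) atTop (𝓝 s₂) ∧
    s = s₁ + s₂

/-- The iterated series `∑_{m_1 ∈ ℤ} ⋯ ∑_{m_k ∈ ℤ} f (m_1, …, m_k)` converges to `s`. -/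
def HasIteratedSum {M : Type*} [AddCommMonoid M] [TopologicalSpace M] :
    {k : ℕ} → ((Fin k → ℤ) → M) → M → Prop
  | 0, f, s => s = f Fin.elim0
  | _ + 1, f, s => ∃ g : ℤ → M,
      (∀ m₁ : ℤ, HasIteratedSum (fun m => f (Fin.cons m₁ m)) (g m₁)) ∧ HasBilateralSum g s

/-- Operator valued functions of operator tuples, on all Hilbert spaces at once:
`F H X` is a bounded operator on `E ⊗ H`. Only the values at points `X` of the regular polyball
of `H` matter. -/
abbrev OpFunction {k : ℕ} (n : Fin k → ℕ) (E : Type u) [NormedAddCommGroup E]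
    [InnerProductSpace ℂ E] : Type (max u (v + 1)) :=
  ∀ (H : Type v) [NormedAddCommGroup H] [InnerProductSpace ℂ H] [CompleteSpace H],
    OpTuple n H → (HTensor E H →L[ℂ] HTensor E H)

section Functions

variable {k : ℕ} {n : Fin k → ℕ} {E : Type u} [NormedAddCommGroup E] [InnerProductSpace ℂ E]

/-- The component of multidegree `m`: the finite sum of `A_{(α;β)} ⊗ X_α X_β^*` over all `(α, β)`
with `|α_i| = m_i^-` and `|β_i| = m_i^+`. -/
def homTerm {H : Type v} [NormedAddCommGroup H] [InnerProductSpace ℂ H] [CompleteSpace H]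
    (A : CoeffIndex n → E →L[ℂ] E) (X : OpTuple n H) (m : Fin k → ℤ) :
    HTensor E H →L[ℂ] HTensor E H :=
  ∑ a : ∀ i, Fin (-(m i)).toNat → Fin (n i), ∑ b : ∀ i, Fin (m i).toNat → Fin (n i),
    opTensor (A (CoeffIndex.ofDegree m a b))
      (monomial X (CoeffIndex.ofDegree m a b).1.1 (CoeffIndex.ofDegree m a b).1.2)

/-- `F` has the representation
`F(X) = ∑_{m_1 ∈ ℤ} ⋯ ∑_{m_k ∈ ℤ} ∑_{|α_i| = m_i^-, |β_i| = m_i^+} A_{(α;β)} ⊗ X_α X_β^*`,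
the series being convergent in the operator norm, at every point of the regular polyball of every
Hilbert space. -/
def HasRepresentation (F : OpFunction.{u, v} n E) (A : CoeffIndex n → E →L[ℂ] E) : Prop :=
  ∀ (H : Type v) [NormedAddCommGroup H] [InnerProductSpace ℂ H] [CompleteSpace H],
    ∀ X ∈ polyball H n, HasIteratedSum (homTerm A X) (F H X)

/-- `F` is a free `k`-pluriharmonic function on the regular polyball, with coefficients
in `B(E)`. -/
def IsFreePluriharmonic (F : OpFunction.{u, v} n E) : Prop :=
  ∃ A : CoeffIndex n → E →L[ℂ] E, HasRepresentation F A

/-- `F` is positive: `F(X) ≥ 0` at every point of the regular polyball of every Hilbert space. -/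
def IsPositiveOnPolyball (F : OpFunction.{u, v} n E) : Prop :=
  ∀ (H : Type v) [NormedAddCommGroup H] [InnerProductSpace ℂ H] [CompleteSpace H],
    ∀ X ∈ polyball H n, (F H X).IsPositive

/-- The function `F_r : X ↦ F(rX)`. -/
def dilate (r : ℝ) (F : OpFunction.{u, v} n E) : OpFunction.{u, v} n E :=
  fun H _ _ _ X => F H ((r : ℂ) • X)

end Functions

/-! ### The kernel of a free `k`-pluriharmonic function -/

/-- `ω` and `γ` are right comparable: one of them is a right factor (a suffix) of the other. -/
def RightComparable {d : ℕ} (ω γ : List (Fin d)) : Prop := γ <:+ ω ∨ ω <:+ γ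

open Classical in
/-- `c_r^+(ω, γ)`: the word `σ` if `ω = σγ`, and the empty word otherwise. The word `c_r^-(ω, γ)`
is `c_r^+(γ, ω)`. -/
def cPlus {d : ℕ} (ω γ : List (Fin d)) : List (Fin d) :=
  if γ <:+ ω then ω.take (ω.length - γ.length) else []

/-- If `ω = σγ`, then `c_r^+(ω, γ) = σ`. -/
theorem cPlus_append {d : ℕ} (σ γ : List (Fin d)) : cPlus (σ ++ γ) γ = σ := by
  simp [cPlus]

theorem cPlus_eq_nil_or {d : ℕ} (ω γ : List (Fin d)) : cPlus ω γ = [] ∨ cPlus γ ω = [] := by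
  unfold cPlus
  by_cases h : γ <:+ ω
  · right
    have := h.length_le
    simp [Nat.sub_eq_zero_of_le this]
  · left
    simp [h]

/-- The index `(c_r^+(σ, ω); c_r^-(σ, ω))`. -/
def cIndex {k : ℕ} {n : Fin k → ℕ} (σ ω : MultiWord n) : CoeffIndex n :=
  ⟨(fun i => cPlus (σ i) (ω i), fun i => cPlus (ω i) (σ i)), fun _ => cPlus_eq_nil_or _ _⟩

section Kernel

variable {k : ℕ} {n : Fin k → ℕ} {E : Type u} [NormedAddCommGroup E] [InnerProductSpace ℂ E]

open Classical in
/-- The kernel `Γ` built from a family of coefficients: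
`Γ(σ, ω) = A_{(c_r^+(σ, ω); c_r^-(σ, ω))}` if `σ` and `ω` are right comparable in every
coordinate, and `Γ(σ, ω) = 0` otherwise. -/
def Gamma (A : CoeffIndex n → E →L[ℂ] E) (σ ω : MultiWord n) : E →L[ℂ] E :=
  if ∀ i, RightComparable (σ i) (ω i) then A (cIndex σ ω) else 0

/-- Positive semi-definite kernels: `∑_{i,j} ⟨K(σ_i, σ_j) h_j, h_i⟩ ≥ 0` for all finite choices
(the inner product of Mathlib is conjugate linear in its first argument). -/
def IsPSDKernel (K : MultiWord n → MultiWord n → E →L[ℂ] E) : Prop :=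
  ∀ (m : ℕ) (h : Fin m → E) (σ : Fin m → MultiWord n),
    0 ≤ ∑ i, ∑ j, ⟪h i, K (σ i) (σ j) (h j)⟫_ℂ

end Kernel

/-! ### The universal model -/

/-- The Hilbert space `F²(H_{n_1}) ⊗ ⋯ ⊗ F²(H_{n_k})`, as the `ℓ²` space over its orthonormal basis
`e_γ = e_{γ_1} ⊗ ⋯ ⊗ e_{γ_k}`, `γ` a multi-word. -/
abbrev Fock {k : ℕ} (n : Fin k → ℕ) : Type v :=
  lp (fun _ : ULift.{v} (MultiWord n) => ℂ) 2

/-- The basis vector `e_γ`. -/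
def fockBasis {k : ℕ} {n : Fin k → ℕ} (γ : MultiWord n) : Fock.{v} n :=
  lp.single 2 (ULift.up γ) (1 : ℂ)

/-- The multi-word obtained from `γ` by replacing `γ_i` by `g_j γ_i`. -/
def consAt {k : ℕ} {n : Fin k → ℕ} (i : Fin k) (j : Fin (n i)) (γ : MultiWord n) : MultiWord n :=
  Function.update γ i (j :: γ i)

theorem consAt_injective {k : ℕ} {n : Fin k → ℕ} (i : Fin k) (j : Fin (n i)) :
    Function.Injective (consAt (n := n) i j) := by
  intro γ γ' h
  funext l
  have hl := congrFun h l
  by_cases hli : l = i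
  · subst hli
    simpa [consAt] using hl
  · simpa [consAt, hli] using hl

theorem orthonormal_fockBasis {k : ℕ} (n : Fin k → ℕ) :
    Orthonormal ℂ (fun γ : ULift.{v} (MultiWord n) => fockBasis.{v} γ.down) := by
  rw [orthonormal_iff_ite]
  intro γ γ'
  simp only [fockBasis, lp.inner_single_left]
  by_cases h : γ = γ'
  · subst h
    simp
  · simp [h]

theorem orthonormal_consAt {k : ℕ} {n : Fin k → ℕ} (i : Fin k) (j : Fin (n i)) :
    Orthonormal ℂ (fun γ : ULift.{v} (MultiWord n) => fockBasis.{v} (consAt i j γ.down)) := by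
  have h := orthonormal_iff_ite.mp (orthonormal_fockBasis.{v} n)
  rw [orthonormal_iff_ite]
  intro γ γ'
  have h' := h (ULift.up (consAt i j γ.down)) (ULift.up (consAt i j γ'.down))
  rw [h']
  simp only [ULift.up_inj, (consAt_injective i j).eq_iff, ← ULift.ext_iff]

/-- The left creation operator `S_{i,j} = I ⊗ ⋯ ⊗ S_j ⊗ ⋯ ⊗ I`: the isometry with
`S_{i,j} e_γ = e_{γ'}`, where `γ'` arises from `γ` by replacing `γ_i` by `g_j γ_i`. -/
def creation {k : ℕ} {n : Fin k → ℕ} (i : Fin k) (j : Fin (n i)) : Fock.{v} n →L[ℂ] Fock.{v} n :=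
  (orthonormal_consAt i j).orthogonalFamily.linearIsometry.toContinuousLinearMap

theorem creation_fockBasis {k : ℕ} {n : Fin k → ℕ} (i : Fin k) (j : Fin (n i))
    (γ : MultiWord n) : creation i j (fockBasis.{v} γ) = fockBasis (consAt i j γ) := by
  simp [creation, fockBasis]

/-- The universal model `S = {S_{i,j}}`. -/
def universalModel {k : ℕ} (n : Fin k → ℕ) : OpTuple n (Fock.{v} n) :=
  fun i j => creation i j

end

end FreePolyball

/-!
Positivity is transported between the universal model `S` and the points of the polyball by a
Poisson transform.

Conditions 2 and 3 say the same thing. If `F` has coefficients `A`, then `F(rS)` is the sum of the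
series with coefficients `r ^ (|α| + |β|) A_{(α;β)}` at `S`. The vector `S_α S_β^* e_ω` is `e_γ` if
`γ = ατ` and `ω = βτ` for some `τ`, and otherwise it is orthogonal to `e_γ`. For an index `(α, β)`
of the series this means that `γ, ω` are right comparable and
`(α, β) = (c_r^+(γ, ω); c_r^-(γ, ω))`, so that the entry of `F(rS)` at `(γ, ω)` picks out a single
coefficient and equals `Γ_{F_r}(γ, ω)` (`entry_of_hasIteratedSum`). Finite combinations of the
vectors `x ⊗ e_γ` are dense, hence `F(rS) ≥ 0` if and only if the kernel is positive semi-definite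
(`isPositive_iff_isPSDKernel`); the same formula at `S / 2` shows that the coefficients are unique
(`HasRepresentation.unique`).

Three properties of the polyball are needed. It contains `rS` for `r < 1`, because the defect
operators of `rS` are diagonal (`smul_universalModel_mem_polyball`); this gives that 1 implies 3.
It is stable under dilations (`smul_mem_polyball`), because `id - Φ` has a positive inverse if `Φ` is
a strictly contractive row map, so that `F_r` makes sense and is pluriharmonic. It is radially open
(`exists_eq_smul_of_mem_polyball`): each point `X` is `tY` with `t < 1` and `Y` in the polyball,
which replaces a limit `r → 1` in the proof that 3 implies 1.

For that implication, a point `Y` of the polyball has a Poisson kernel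
`K h = ∑_γ e_γ ⊗ Δ_Y(I)^{1/2} Y_γ^* h` (`exists_poissonKernel`). It is an isometry because
`∑_γ Y_γ Δ_Y(I) Y_γ^*` telescopes to `I` (`hasSum_norm_sq_defect`), and it intertwines `Y_{i,j}^*`
with `S_{i,j}^* ⊗ I`, so that `Y_α Y_β^* = K^* (S_α S_β^* ⊗ I) K`. The map
`T ↦ (I ⊗ K)^* (T ⊗ I) (I ⊗ K)` is positive and norm continuous, and it maps the series of `F(tS)`
term by term to that of `F(tY) = F(X)` (`isPositive_of_universalModel`).
-/

namespace FreePolyball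

noncomputable section

/-! ### Iterated bilateral series -/

section IteratedSum

variable {M N : Type*} [AddCommMonoid M] [TopologicalSpace M] [AddCommMonoid N]
  [TopologicalSpace N]

theorem HasBilateralSum.map {g : ℤ → M} {s : M} (h : HasBilateralSum g s) (φ : M →+ N)
    (hφ : Continuous φ) : HasBilateralSum (fun m => φ (g m)) (φ s) := by
  obtain ⟨s₁, s₂, h₁, h₂, rfl⟩ := h
  refine ⟨φ s₁, φ s₂, ?_, ?_, map_add φ _ _⟩
  · simpa [Function.comp_def] using (hφ.tendsto s₁).comp h₁
  · simpa [Function.comp_def] using (hφ.tendsto s₂).comp h₂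

theorem HasBilateralSum.unique [T2Space M] {g : ℤ → M} {s t : M} (hs : HasBilateralSum g s)
    (ht : HasBilateralSum g t) : s = t := by
  obtain ⟨s₁, s₂, h₁, h₂, rfl⟩ := hs
  obtain ⟨t₁, t₂, h₁', h₂', rfl⟩ := ht
  rw [tendsto_nhds_unique h₁ h₁', tendsto_nhds_unique h₂ h₂']

theorem hasBilateralSum_single (m₀ : ℤ) {g : ℤ → M} (hg : ∀ m, m ≠ m₀ → g m = 0) :
    HasBilateralSum g (g m₀) := by
  rcases le_or_gt 0 m₀ with h | h
  · refine ⟨0, g m₀, ?_, ?_, (zero_add _).symm⟩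
    · refine tendsto_const_nhds.congr fun N => (Finset.sum_eq_zero fun j _ => hg _ ?_).symm
      lia
    · refine tendsto_const_nhds.congr' ?_
      filter_upwards [eventually_gt_atTop m₀.toNat] with N hN
      rw [Finset.sum_eq_single_of_mem m₀.toNat (by simpa using hN)]
      · rw [Int.toNat_of_nonneg h]
      · intro j _ hj
        exact hg _ (by lia)
  · refine ⟨g m₀, 0, ?_, ?_, (add_zero _).symm⟩
    · refine tendsto_const_nhds.congr' ?_
      filter_upwards [eventually_gt_atTop (-m₀ - 1).toNat] with N hN
      rw [Finset.sum_eq_single_of_mem (-m₀ - 1).toNat (by simpa using hN)]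
      · congr 1
        lia
      · intro j _ hj
        exact hg _ (by lia)
    · refine tendsto_const_nhds.congr fun N => (Finset.sum_eq_zero fun j _ => hg _ ?_).symm
      lia

theorem HasIteratedSum.map (φ : M →+ N) (hφ : Continuous φ) :
    ∀ {k : ℕ} {f : (Fin k → ℤ) → M} {s : M}, HasIteratedSum f s →
      HasIteratedSum (fun m => φ (f m)) (φ s)
  | 0, _, _, h => congrArg φ h
  | _ + 1, _, _, ⟨g, hg, hs⟩ => ⟨fun m => φ (g m), fun m₁ => (hg m₁).map φ hφ, hs.map φ hφ⟩

theorem HasIteratedSum.unique [T2Space M] :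
    ∀ {k : ℕ} {f : (Fin k → ℤ) → M} {s t : M}, HasIteratedSum f s → HasIteratedSum f t → s = t
  | 0, _, _, _, hs, ht => Eq.trans hs (Eq.symm ht)
  | _ + 1, _, _, _, ⟨g, hg, hs⟩, ⟨g', hg', ht⟩ => by
    obtain rfl : g = g' := funext fun m => (hg m).unique (hg' m)
    exact hs.unique ht

/-- An iterated series with at most one non-zero term converges to that term. -/
theorem hasIteratedSum_single :
    ∀ {k : ℕ} (m₀ : Fin k → ℤ) {f : (Fin k → ℤ) → M}, (∀ m, m ≠ m₀ → f m = 0) →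
      HasIteratedSum f (f m₀)
  | 0, m₀, f, _ => congrArg f (Subsingleton.elim _ _)
  | k + 1, m₀, f, hf => by
    refine ⟨fun m₁ => f (Fin.cons m₁ (Fin.tail m₀)), fun m₁ => ?_, ?_⟩
    · refine hasIteratedSum_single (Fin.tail m₀) fun m hm => hf _ fun h => hm ?_
      rw [← h, Fin.tail_cons]
    · have := hasBilateralSum_single (m₀ 0) (g := fun m₁ => f (Fin.cons m₁ (Fin.tail m₀)))
        fun m hm => hf _ fun h => hm (by rw [← h, Fin.cons_zero])
      simpa only [Fin.cons_self_tail] using this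

end IteratedSum

/-! ### Operators on Hilbert tensor products -/

section Tensor

variable {E : Type*} {H : Type*} [NormedAddCommGroup E] [InnerProductSpace ℂ E]
  [NormedAddCommGroup H] [InnerProductSpace ℂ H]

/-- The elementary tensor `x ⊗ y` of the Hilbert tensor product, bilinear and continuous in each
variable. -/
def tmulL : E →L[ℂ] H →L[ℂ] HTensor E H :=
  (ContinuousLinearMap.compL ℂ H (E ⊗[ℂ] H) (HTensor E H)
    UniformSpace.Completion.toComplL).comp (TensorProduct.mkL ℂ E H)

theorem tmulL_apply (x : E) (y : H) :
    tmulL x y = ((x ⊗ₜ[ℂ] y : E ⊗[ℂ] H) : HTensor E H) := rfl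

theorem inner_tmulL (x x' : E) (y y' : H) :
    ⟪tmulL x y, tmulL x' y'⟫_ℂ = ⟪x, x'⟫_ℂ * ⟪y, y'⟫_ℂ := by
  simp [tmulL_apply, UniformSpace.Completion.inner_coe]

@[simp]
theorem opTensor_tmulL (A : E →L[ℂ] E) (T : H →L[ℂ] H) (x : E) (y : H) :
    opTensor A T (tmulL x y) = tmulL (A x) (T y) :=
  opTensor_tmul A T x y

/-- Elementary tensors `x ⊗ y` with `y` in a total subset of `H` are total in `E ⊗ H`. -/
theorem dense_span_tmulL {s : Set H} (hs : Dense (Submodule.span ℂ s : Set H)) :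
    Dense (Submodule.span ℂ {z : HTensor E H | ∃ x, ∃ y ∈ s, tmulL x y = z} :
      Set (HTensor E H)) := by
  set V := Submodule.span ℂ {z : HTensor E H | ∃ x, ∃ y ∈ s, tmulL x y = z} with hV
  have key : ∀ (x : E) (y : H), tmulL x y ∈ V.topologicalClosure := fun x y => by
    have hle : Submodule.span ℂ s ≤
        V.topologicalClosure.comap (tmulL x : H →L[ℂ] HTensor E H).toLinearMap := by
      refine Submodule.span_le.mpr fun z hz => ?_
      exact V.le_topologicalClosure (Submodule.subset_span ⟨x, z, hz, rfl⟩)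
    have hcl : IsClosed {y : H | tmulL x y ∈ V.topologicalClosure} :=
      V.isClosed_topologicalClosure.preimage (tmulL x : H →L[ℂ] HTensor E H).continuous
    exact hcl.closure_subset_iff.mpr (fun z hz => hle hz) (hs y)
  have hall : ∀ z : E ⊗[ℂ] H, (z : HTensor E H) ∈ V.topologicalClosure := fun z => by
    induction z with
    | zero => exact zero_mem _
    | tmul x y => exact key x y
    | add a b ha hb =>
      rw [UniformSpace.Completion.coe_add]
      exact add_mem ha hb
  refine dense_closure.mp (UniformSpace.Completion.denseRange_coe.mono ?_)
  rintro _ ⟨z, rfl⟩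
  exact hall z

theorem dense_span_range_tmulL :
    Dense (Submodule.span ℂ {z : HTensor E H | ∃ x, ∃ y, tmulL x y = z} :
      Set (HTensor E H)) := by
  simpa using dense_span_tmulL (E := E) (H := H) (s := Set.univ) (by simp)

/-- Bounded operators on `E ⊗ H` are determined by their values at elementary tensors. -/
theorem HTensor.clm_ext {G : Type*} [NormedAddCommGroup G] [NormedSpace ℂ G]
    {S T : HTensor E H →L[ℂ] G} (h : ∀ x y, S (tmulL x y) = T (tmulL x y)) : S = T := by
  refine ContinuousLinearMap.ext_on dense_span_range_tmulL ?_
  rintro _ ⟨x, y, rfl⟩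
  exact h x y

theorem opTensor_mul (A B : E →L[ℂ] E) (S T : H →L[ℂ] H) :
    opTensor (A * B) (S * T) = opTensor A S * opTensor B T :=
  HTensor.clm_ext fun x y => by simp

theorem opTensor_add_left (A B : E →L[ℂ] E) (T : H →L[ℂ] H) :
    opTensor (A + B) T = opTensor A T + opTensor B T :=
  HTensor.clm_ext fun x y => by simp

theorem opTensor_smul_left (c : ℂ) (A : E →L[ℂ] E) (T : H →L[ℂ] H) :
    opTensor (c • A) T = c • opTensor A T :=
  HTensor.clm_ext fun x y => by simp

theorem opTensor_smul_right (c : ℂ) (A : E →L[ℂ] E) (T : H →L[ℂ] H) :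
    opTensor A (c • T) = c • opTensor A T :=
  HTensor.clm_ext fun x y => by simp

theorem norm_opTensor_le (A : E →L[ℂ] E) (T : H →L[ℂ] H) : ‖opTensor A T‖ ≤ ‖A‖ * ‖T‖ := by
  refine ContinuousLinearMap.opNorm_le_bound _ (by positivity) fun z => ?_
  induction z using UniformSpace.Completion.induction_on with
  | hp => exact isClosed_le (by fun_prop) (by fun_prop)
  | ih z =>
    rw [opTensor, ContinuousLinearMap.completion_apply_coe, UniformSpace.Completion.norm_coe,
      UniformSpace.Completion.norm_coe]
    exact (ContinuousLinearMap.le_opNorm _ z).trans (by gcongr; exact TensorProduct.norm_mapL_le A T)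

/-- The ampliation `A ↦ A ⊗ T` with a fixed second factor. -/
def ampliation (T : H →L[ℂ] H) : (E →L[ℂ] E) →+ (HTensor E H →L[ℂ] HTensor E H) :=
  AddMonoidHom.mk' (fun A => opTensor A T) fun A B => opTensor_add_left A B T

theorem continuous_ampliation (T : H →L[ℂ] H) : Continuous (ampliation (E := E) T) := by
  refine AddMonoidHomClass.continuous_of_bound (ampliation (E := E) T) ‖T‖ fun A => ?_
  rw [mul_comm]
  exact norm_opTensor_le A T

theorem adjoint_opTensor [CompleteSpace E] [CompleteSpace H] (A : E →L[ℂ] E) (T : H →L[ℂ] H) :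
    ContinuousLinearMap.adjoint (opTensor A T) =
      opTensor (ContinuousLinearMap.adjoint A) (ContinuousLinearMap.adjoint T) := by
  refine HTensor.clm_ext fun x y => ?_
  refine dense_span_range_tmulL.eq_of_inner_left (𝕜 := ℂ) fun v hv => ?_
  induction hv using Submodule.span_induction with
  | mem v hv =>
    obtain ⟨x', y', rfl⟩ := hv
    rw [ContinuousLinearMap.adjoint_inner_left, opTensor_tmulL, opTensor_tmulL, inner_tmulL,
      inner_tmulL, ContinuousLinearMap.adjoint_inner_left, ContinuousLinearMap.adjoint_inner_left]
  | zero => rw [inner_zero_right, inner_zero_right]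
  | add v w _ _ hv hw => rw [inner_add_right, inner_add_right, hv, hw]
  | smul c v _ hv => rw [inner_smul_right, inner_smul_right, hv]

end Tensor

/-! ### Positivity -/

theorem isPositive_iff_inner {G : Type*} [NormedAddCommGroup G] [InnerProductSpace ℂ G]
    (T : G →L[ℂ] G) : T.IsPositive ↔ ∀ x, 0 ≤ ⟪x, T x⟫_ℂ := by
  refine ⟨fun h x => h.inner_nonneg_right x, fun h => ?_⟩
  rw [ContinuousLinearMap.isPositive_iff_complex]
  intro x
  have h1 := h x
  rw [← inner_conj_symm]
  rw [RCLike.nonneg_iff] at h1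
  have h2 : (starRingEnd ℂ) ⟪x, T x⟫_ℂ = ⟪x, T x⟫_ℂ := Complex.conj_eq_iff_im.mpr h1.2
  rw [h2]
  exact ⟨Complex.ext (by simp) (by simpa using h1.2.symm), h1.1⟩

/-- Positivity of an operator needs to be tested on a dense set of vectors only. -/
theorem isPositive_of_dense {G : Type*} [NormedAddCommGroup G] [InnerProductSpace ℂ G]
    {T : G →L[ℂ] G} {s : Set G} (hs : Dense s) (h : ∀ x ∈ s, 0 ≤ ⟪x, T x⟫_ℂ) :
    T.IsPositive := by
  refine (isPositive_iff_inner T).mpr fun x => ?_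
  have hcl : IsClosed {x : G | 0 ≤ ⟪x, T x⟫_ℂ} :=
    isClosed_Ici.preimage (f := fun x : G => ⟪x, T x⟫_ℂ) (by fun_prop)
  exact hcl.closure_subset_iff.mpr h (hs x)

/-- Ampliations of positive operators are positive, as `R^* R ⊗ I = (R ⊗ I)^* (R ⊗ I)`. -/
theorem isPositive_opTensor_one {E H : Type*} [NormedAddCommGroup E] [InnerProductSpace ℂ E]
    [NormedAddCommGroup H] [InnerProductSpace ℂ H] [CompleteSpace E] [CompleteSpace H]
    {T : E →L[ℂ] E} (hT : T.IsPositive) : (opTensor T (1 : H →L[ℂ] H)).IsPositive := by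
  rw [← ContinuousLinearMap.nonneg_iff_isPositive,
    CStarAlgebra.nonneg_iff_eq_star_mul_self] at hT
  obtain ⟨R, rfl⟩ := hT
  rw [← mul_one (1 : H →L[ℂ] H), opTensor_mul]
  have : opTensor (star R) (1 : H →L[ℂ] H) = ContinuousLinearMap.adjoint (opTensor R 1) := by
    rw [adjoint_opTensor, ← ContinuousLinearMap.star_eq_adjoint, ← ContinuousLinearMap.star_eq_adjoint, star_one]
  rw [this]
  exact ContinuousLinearMap.isPositive_adjoint_comp_self _

/-! ### Defect maps and dilations of the polyball -/

section Defect

variable {H : Type*} [NormedAddCommGroup H] [InnerProductSpace ℂ H] [CompleteSpace H]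

/-- The conjugation `Y ↦ T Y T^*`. -/
def conjOp (T : H →L[ℂ] H) : Module.End ℂ (H →L[ℂ] H) :=
  LinearMap.mulLeftRight ℂ (T, ContinuousLinearMap.adjoint T)

theorem conjOp_apply (T Z : H →L[ℂ] H) : conjOp T Z = T * Z * star T :=
  LinearMap.mulLeftRight_apply _ _ _

theorem conjOp_mul (S T : H →L[ℂ] H) : conjOp (S * T) = conjOp S * conjOp T := by
  refine LinearMap.ext fun Z => ?_
  simp only [conjOp_apply, Module.End.mul_apply, star_mul, mul_assoc]

theorem conjOp_one : conjOp (1 : H →L[ℂ] H) = 1 :=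
  LinearMap.ext fun Z => by simp [conjOp_apply]

theorem Phi_eq_sum {d : ℕ} (T : Fin d → H →L[ℂ] H) : Phi T = ∑ j, conjOp (T j) := rfl

theorem Phi_apply {d : ℕ} (T : Fin d → H →L[ℂ] H) (Z : H →L[ℂ] H) :
    Phi T Z = ∑ j, T j * Z * star (T j) := by
  simp [Phi_eq_sum, conjOp_apply, LinearMap.sum_apply]

theorem Phi_nonneg {d : ℕ} (T : Fin d → H →L[ℂ] H) {Z : H →L[ℂ] H} (hZ : 0 ≤ Z) :
    0 ≤ Phi T Z := by
  rw [Phi_apply]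
  exact Finset.sum_nonneg fun j _ => star_right_conjugate_nonneg hZ _

theorem isSelfAdjoint_Phi {d : ℕ} (T : Fin d → H →L[ℂ] H) {Z : H →L[ℂ] H}
    (hZ : IsSelfAdjoint Z) : IsSelfAdjoint (Phi T Z) := by
  simp [Phi_apply, IsSelfAdjoint, star_sum, hZ.star_eq, mul_assoc]

theorem Phi_smul {d : ℕ} (s : ℝ) (T : Fin d → H →L[ℂ] H) :
    Phi ((s : ℂ) • T) = ((s ^ 2 : ℝ) : ℂ) • Phi T := by
  refine LinearMap.ext fun Z => ?_
  rw [LinearMap.smul_apply, Phi_apply, Phi_apply, Finset.smul_sum]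
  refine Finset.sum_congr rfl fun j _ => ?_
  simp only [Pi.smul_apply, star_smul, smul_mul_assoc, mul_smul_comm, smul_smul]
  congr 1
  simp [sq]

/-- The left side is `⟪x, Φ_T(I) x⟫`. -/
theorem sum_norm_sq_adjoint {d : ℕ} (T : Fin d → H →L[ℂ] H) (x : H) :
    ∑ j, ‖ContinuousLinearMap.adjoint (T j) x‖ ^ 2 ≤ ‖Phi T 1‖ * ‖x‖ ^ 2 := by
  have h : ((∑ j, ‖ContinuousLinearMap.adjoint (T j) x‖ ^ 2 : ℝ) : ℂ) = ⟪x, Phi T 1 x⟫_ℂ := by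
    rw [Phi_apply, sum_apply, inner_sum]
    push_cast
    refine Finset.sum_congr rfl fun j _ => ?_
    change _ = ⟪x, T j (star (T j) x)⟫_ℂ
    rw [← ContinuousLinearMap.adjoint_inner_left,
      ContinuousLinearMap.star_eq_adjoint, inner_self_eq_norm_sq_to_K]
    rfl
  have h' := congrArg (fun z : ℂ => ‖z‖) h
  simp only [Complex.norm_real] at h'
  calc _ ≤ ‖∑ j, ‖ContinuousLinearMap.adjoint (T j) x‖ ^ 2‖ := le_abs_self _
    _ = ‖⟪x, Phi T 1 x⟫_ℂ‖ := h'
    _ ≤ ‖x‖ * ‖Phi T 1 x‖ := norm_inner_le_norm _ _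
    _ ≤ ‖x‖ * (‖Phi T 1‖ * ‖x‖) := by gcongr; exact ContinuousLinearMap.le_opNorm _ _
    _ = _ := by ring

/-- `Φ_T` attains its norm at the identity. -/
theorem norm_Phi_le {d : ℕ} (T : Fin d → H →L[ℂ] H) (Z : H →L[ℂ] H) :
    ‖Phi T Z‖ ≤ ‖Phi T 1‖ * ‖Z‖ := by
  have key : ∀ x y : H, ‖⟪x, Phi T Z y⟫_ℂ‖ ≤ ‖Phi T 1‖ * ‖Z‖ * ‖x‖ * ‖y‖ := fun x y => by
    set a : Fin d → ℝ := fun j => ‖ContinuousLinearMap.adjoint (T j) x‖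
    set b : Fin d → ℝ := fun j => ‖ContinuousLinearMap.adjoint (T j) y‖
    have h1 : ‖⟪x, Phi T Z y⟫_ℂ‖ ≤ ‖Z‖ * ∑ j, a j * b j := by
      rw [Phi_apply, sum_apply, inner_sum, Finset.mul_sum]
      refine norm_sum_le_of_le _ fun j _ => ?_
      rw [mul_assoc, mul_apply_eq_comp, ← ContinuousLinearMap.adjoint_inner_left]
      calc _ ≤ a j * ‖(Z * star (T j)) y‖ := norm_inner_le_norm _ _
        _ ≤ a j * (‖Z‖ * b j) := by
          gcongr
          exact ContinuousLinearMap.le_opNorm Z (ContinuousLinearMap.adjoint (T j) y)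
        _ = _ := by ring
    have h2 : ∑ j, a j * b j ≤ √(∑ j, a j ^ 2) * √(∑ j, b j ^ 2) :=
      Real.sum_mul_le_sqrt_mul_sqrt _ _ _
    have h3 : √(∑ j, a j ^ 2) * √(∑ j, b j ^ 2) ≤
        √(‖Phi T 1‖ * ‖x‖ ^ 2) * √(‖Phi T 1‖ * ‖y‖ ^ 2) := by
      gcongr
      · exact sum_norm_sq_adjoint T x
      · exact sum_norm_sq_adjoint T y
    have h4 : √(‖Phi T 1‖ * ‖x‖ ^ 2) * √(‖Phi T 1‖ * ‖y‖ ^ 2) = ‖Phi T 1‖ * ‖x‖ * ‖y‖ := by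
      rw [← Real.sqrt_mul (by positivity), Real.sqrt_eq_iff_mul_self_eq (by positivity)
        (by positivity)]
      ring
    calc _ ≤ ‖Z‖ * ∑ j, a j * b j := h1
      _ ≤ ‖Z‖ * (‖Phi T 1‖ * ‖x‖ * ‖y‖) := by
        gcongr
        exact h2.trans (h3.trans h4.le)
      _ = _ := by ring
  refine ContinuousLinearMap.opNorm_le_bound _ (by positivity) fun y => ?_
  rcases eq_or_ne (Phi T Z y) 0 with h0 | h0
  · rw [h0, norm_zero]
    positivity
  · refine le_of_mul_le_mul_left ?_ (norm_pos_iff.mpr h0)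
    have := key (Phi T Z y) y
    rw [inner_self_eq_norm_sq_to_K] at this
    simp only [Complex.coe_algebraMap, norm_pow, Complex.norm_real, norm_norm] at this
    nlinarith

theorem norm_Phi_pow_le {d : ℕ} (T : Fin d → H →L[ℂ] H) (Z : H →L[ℂ] H) (m : ℕ) :
    ‖(Phi T ^ m) Z‖ ≤ ‖Phi T 1‖ ^ m * ‖Z‖ := by
  induction m with
  | zero => simp
  | succ m ih =>
    rw [pow_succ', Module.End.mul_apply, pow_succ', mul_assoc]
    exact (norm_Phi_le T _).trans (by gcongr)

theorem continuous_Phi {d : ℕ} (T : Fin d → H →L[ℂ] H) : Continuous (Phi T) :=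
  AddMonoidHomClass.continuous_of_bound (Phi T) _ (norm_Phi_le T)

theorem Phi_commute {d e : ℕ} {S : Fin d → H →L[ℂ] H} {T : Fin e → H →L[ℂ] H}
    (h : ∀ a b, Commute (S a) (T b)) : Commute (Phi S) (Phi T) := by
  refine Commute.sum_left _ _ _ fun a _ => Commute.sum_right _ _ _ fun b _ => ?_
  change conjOp (S a) * conjOp (T b) = conjOp (T b) * conjOp (S a)
  rw [← conjOp_mul, ← conjOp_mul, (h a b).eq]

/-- If `Φ_T` is a strict contraction, then `id - Φ_T` has a positive inverse: `Z ≥ Φ_T (Z)` can be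
iterated to `Z ≥ Φ_T ^ m (Z) → 0`. -/
theorem nonneg_of_Phi_le {d : ℕ} {T : Fin d → H →L[ℂ] H} (hT : ‖Phi T 1‖ < 1)
    {Z : H →L[ℂ] H} (hZ : Phi T Z ≤ Z) : 0 ≤ Z := by
  have hpos : ∀ m : ℕ, ∀ Y : H →L[ℂ] H, 0 ≤ Y → 0 ≤ (Phi T ^ m) Y := fun m => by
    induction m with
    | zero => exact fun Y hY => hY
    | succ m ih =>
      intro Y hY
      rw [pow_succ', Module.End.mul_apply]
      exact Phi_nonneg T (ih Y hY)
  have hle : ∀ m : ℕ, (Phi T ^ m) Z ≤ Z := fun m => by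
    induction m with
    | zero => simp
    | succ m ih =>
      refine le_trans ?_ ih
      have := hpos m (Z - Phi T Z) (sub_nonneg.mpr hZ)
      rwa [map_sub, sub_nonneg, ← Module.End.mul_apply, ← pow_succ] at this
  have hlim : Tendsto (fun m => (Phi T ^ m) Z) atTop (𝓝 0) := by
    refine squeeze_zero_norm (norm_Phi_pow_le T Z) ?_
    simpa using (tendsto_pow_atTop_nhds_zero_of_lt_one (norm_nonneg _) hT).mul_const ‖Z‖
  exact le_of_tendsto' hlim hle

variable {k : ℕ} {n : Fin k → ℕ}

/-- The defect map restricted to the coordinates in a list. -/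
def partialDefect (X : OpTuple n H) (l : List (Fin k)) : Module.End ℂ (H →L[ℂ] H) :=
  (l.map fun i => (1 : Module.End ℂ (H →L[ℂ] H)) - Phi (X i)).prod

theorem defectMap_eq (X : OpTuple n H) : defectMap X = partialDefect X (List.finRange k) := by
  rw [defectMap, partialDefect, List.ofFn_eq_map]

@[simp]
theorem partialDefect_nil_apply (X : OpTuple n H) (Z : H →L[ℂ] H) :
    partialDefect X [] Z = Z := rfl

theorem partialDefect_cons_apply (X : OpTuple n H) (i : Fin k) (l : List (Fin k))
    (Z : H →L[ℂ] H) :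
    partialDefect X (i :: l) Z = partialDefect X l Z - Phi (X i) (partialDefect X l Z) := by
  simp [partialDefect]

theorem isSelfAdjoint_partialDefect (X : OpTuple n H) (l : List (Fin k)) {Z : H →L[ℂ] H}
    (hZ : IsSelfAdjoint Z) : IsSelfAdjoint (partialDefect X l Z) := by
  induction l with
  | nil => exact hZ
  | cons i l ih =>
    rw [partialDefect_cons_apply]
    exact ih.sub (isSelfAdjoint_Phi _ ih)

theorem commute_partialDefect {X : OpTuple n H} {Ψ : Module.End ℂ (H →L[ℂ] H)}
    (h : ∀ j : Fin k, Commute Ψ (Phi (X j))) (l : List (Fin k)) :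
    Commute Ψ (partialDefect X l) := by
  refine Commute.list_prod_right _ _ fun y hy => ?_
  obtain ⟨j, -, rfl⟩ := List.mem_map.mp hy
  exact (Commute.one_right _).sub_right (h j)

theorem Phi_commute_of_commute {X : OpTuple n H}
    (hX : ∀ s t : Fin k, s ≠ t → ∀ a b, Commute (X s a) (X t b)) (i j : Fin k) :
    Commute (Phi (X i)) (Phi (X j)) := by
  rcases eq_or_ne i j with rfl | h
  · exact Commute.refl _
  · exact Phi_commute (hX i j h)

/-- Shrinking a tuple increases its defect operators. One coordinate at a time this is the convex
combination `id - r² Φ = (1 - r²) id + r² (id - Φ)` together with `(id - Φ) Q ≤ Q` for `Q ≥ 0`. -/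
theorem partialDefect_le_dilate {X : OpTuple n H}
    (hX : ∀ s t : Fin k, s ≠ t → ∀ a b, Commute (X s a) (X t b))
    (hX' : ∀ i, ‖Phi (X i) 1‖ < 1) {r : ℝ} (hr : r ∈ Set.Icc (0 : ℝ) 1) (l : List (Fin k)) :
    ∀ Z : H →L[ℂ] H, 0 ≤ partialDefect X l Z →
      partialDefect X l Z ≤ partialDefect ((r : ℂ) • X) l Z := by
  have hc : ∀ i, Phi (((r : ℂ) • X) i) = ((r ^ 2 : ℝ) : ℂ) • Phi (X i) := fun i => Phi_smul r (X i)
  have hcomm := Phi_commute_of_commute hX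
  induction l with
  | nil => exact fun Z _ => le_rfl
  | cons i l ih =>
    intro Z hZ
    set Q := partialDefect X l Z with hQ
    set Q' := partialDefect ((r : ℂ) • X) l Z with hQ'
    have hswap : ∀ Y : OpTuple n H, (∀ j, Commute (Phi (X i)) (Phi (Y j))) →
        partialDefect Y l (Z - Phi (X i) Z) =
          partialDefect Y l Z - Phi (X i) (partialDefect Y l Z) := fun Y hY => by
      rw [map_sub, ← Module.End.mul_apply, ← (commute_partialDefect hY l).eq]
      rfl
    have e1 := hswap X (hcomm i)
    have e2 := hswap ((r : ℂ) • X) fun j => by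
      rw [hc]
      exact (hcomm i j).smul_right _
    rw [← hQ] at e1
    rw [← hQ'] at e2
    rw [partialDefect_cons_apply] at hZ ⊢
    rw [partialDefect_cons_apply, ← hQ, ← hQ']
    rw [← hQ] at hZ
    have hQ0 : 0 ≤ Q := nonneg_of_Phi_le (hX' i) (sub_nonneg.mp hZ)
    have hPQ : Q - Phi (X i) Q ≤ Q := sub_le_self _ (Phi_nonneg _ hQ0)
    have hQQ' : Q ≤ Q' := ih Z hQ0
    have h3 := ih (Z - Phi (X i) Z) (by rwa [e1])
    rw [e1, e2] at h3
    have hr2 : (0 : ℂ) ≤ ((r ^ 2 : ℝ) : ℂ) := by exact_mod_cast sq_nonneg r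
    have hr2' : (0 : ℂ) ≤ ((1 - r ^ 2 : ℝ) : ℂ) := by
      have : 0 ≤ 1 - r ^ 2 := by nlinarith [hr.1, hr.2]
      exact_mod_cast this
    have hsplit : Q' - Phi (((r : ℂ) • X) i) Q' = ((1 - r ^ 2 : ℝ) : ℂ) • Q' +
        ((r ^ 2 : ℝ) : ℂ) • (Q' - Phi (X i) Q') := by
      rw [hc, LinearMap.smul_apply]
      push_cast
      module
    rw [hsplit]
    calc Q - Phi (X i) Q = ((1 - r ^ 2 : ℝ) : ℂ) • (Q - Phi (X i) Q) +
        ((r ^ 2 : ℝ) : ℂ) • (Q - Phi (X i) Q) := by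
          push_cast
          module
      _ ≤ _ := add_le_add (smul_le_smul_of_nonneg_left (hPQ.trans hQQ') hr2')
          (smul_le_smul_of_nonneg_left h3 hr2)

theorem mem_polyball_iff (X : OpTuple n H) :
    X ∈ polyball H n ↔ (∀ s t : Fin k, s ≠ t → ∀ a b, Commute (X s a) (X t b)) ∧
      (∀ i, ‖Phi (X i) 1‖ < 1) ∧ IsStrictlyPositive (partialDefect X (List.finRange k) 1) := by
  simp [polyball, defectMap_eq, Phi_apply, ContinuousLinearMap.star_eq_adjoint]

theorem commute_smul {G : Type*} [NormedAddCommGroup G] [InnerProductSpace ℂ G] {X : OpTuple n G}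
    (hX : ∀ s t : Fin k, s ≠ t → ∀ a b, Commute (X s a) (X t b)) (c : ℂ) (s t : Fin k)
    (hst : s ≠ t) (a : Fin (n s)) (b : Fin (n t)) : Commute ((c • X) s a) ((c • X) t b) :=
  ((hX s t hst a b).smul_left c).smul_right c

theorem norm_Phi_smul {d : ℕ} (r : ℝ) (T : Fin d → H →L[ℂ] H) :
    ‖Phi ((r : ℂ) • T) 1‖ = r ^ 2 * ‖Phi T 1‖ := by
  rw [Phi_smul, LinearMap.smul_apply, norm_smul, Complex.norm_real,
    Real.norm_of_nonneg (sq_nonneg r)]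

/-- The polyball is stable under dilations by `r ∈ [0, 1]`. -/
theorem smul_mem_polyball {X : OpTuple n H} (hX : X ∈ polyball H n) {r : ℝ}
    (hr : r ∈ Set.Icc (0 : ℝ) 1) : (r : ℂ) • X ∈ polyball H n := by
  rw [mem_polyball_iff] at hX ⊢
  obtain ⟨h1, h2, h3⟩ := hX
  refine ⟨commute_smul h1 _, fun i => ?_, h3.of_le (partialDefect_le_dilate h1 h2 hr _ _ h3.nonneg)⟩
  rw [Pi.smul_apply, norm_Phi_smul]
  refine lt_of_le_of_lt (mul_le_of_le_one_left (norm_nonneg _) ?_) (h2 i)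
  exact pow_le_one₀ hr.1 hr.2

theorem continuous_partialDefect_smul (X : OpTuple n H) (l : List (Fin k)) (Z : H →L[ℂ] H) :
    Continuous fun s : ℝ => partialDefect ((s : ℂ) • X) l Z := by
  induction l with
  | nil => exact continuous_const
  | cons i l ih =>
    simp only [partialDefect_cons_apply, Pi.smul_apply, Phi_smul, LinearMap.smul_apply]
    have := (continuous_Phi (X i)).comp ih
    simp only [Function.comp_def] at this
    fun_prop

theorem isStrictlyPositive_of_algebraMap_le {c : ℝ} (hc : 0 < c) {T : H →L[ℂ] H}
    (h : algebraMap ℝ (H →L[ℂ] H) c ≤ T) : IsStrictlyPositive T := by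
  refine IsStrictlyPositive.of_le (IsStrictlyPositive.iff_of_unital.mpr ⟨?_, ?_⟩) h
  · exact algebraMap_nonneg _ hc.le
  · exact (IsUnit.mk0 c hc.ne').map (algebraMap ℝ (H →L[ℂ] H))

theorem norm_Phi_one_le_one {d : ℕ} {T : Fin d → H →L[ℂ] H} (h : Phi T 1 ≤ 1) :
    ‖Phi T 1‖ ≤ 1 :=
  (CStarAlgebra.norm_le_one_iff_of_nonneg _ (Phi_nonneg T zero_le_one)).mpr h

/-- The set of strictly positive elements is open in the space of self-adjoint operators. -/
theorem eventually_isStrictlyPositive {D : ℝ → H →L[ℂ] H} (hD : Continuous D)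
    (hsa : ∀ s, IsSelfAdjoint (D s)) {s₀ : ℝ} (h : IsStrictlyPositive (D s₀)) :
    ∀ᶠ s in 𝓝 s₀, IsStrictlyPositive (D s) := by
  rcases subsingleton_or_nontrivial (H →L[ℂ] H) with hS | hN
  · exact Eventually.of_forall fun s => Subsingleton.elim (D s₀) (D s) ▸ h
  obtain ⟨c, hc, hle⟩ : ∃ c > 0, algebraMap ℝ (H →L[ℂ] H) c ≤ D s₀ :=
    (CFC.exists_pos_algebraMap_le_iff (hsa s₀)).mpr fun x hx => h.spectrum_pos hx
  have hev : ∀ᶠ s in 𝓝 s₀, ‖D s - D s₀‖ < c / 2 := by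
    have := (hD.sub continuous_const).norm.tendsto s₀ (f := fun s => ‖D s - D s₀‖)
    rw [sub_self, norm_zero] at this
    exact this.eventually (gt_mem_nhds (half_pos hc))
  filter_upwards [hev] with s hs
  refine isStrictlyPositive_of_algebraMap_le (half_pos hc) ?_
  have h1 := ((hsa s).sub (hsa s₀)).neg_algebraMap_norm_le_self
  have h2 : algebraMap ℝ (H →L[ℂ] H) ‖D s - D s₀‖ ≤ algebraMap ℝ _ (c / 2) :=
    algebraMap_mono _ hs.le
  calc algebraMap ℝ (H →L[ℂ] H) (c / 2)
      = -algebraMap ℝ (H →L[ℂ] H) (c / 2) + algebraMap ℝ _ c := by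
        rw [← map_neg, ← map_add]
        congr 1
        ring
    _ ≤ (D s - D s₀) + D s₀ := add_le_add ((neg_le_neg h2).trans h1) hle
    _ = D s := sub_add_cancel _ _

/-- The polyball is radially open: each of its points is a proper dilate of another one. -/
theorem exists_eq_smul_of_mem_polyball {X : OpTuple n H} (hX : X ∈ polyball H n) :
    ∃ t ∈ Set.Ioo (0 : ℝ) 1, ∃ Y ∈ polyball H n, X = (t : ℂ) • Y := by
  obtain ⟨h1, h2, h3⟩ := (mem_polyball_iff X).mp hX
  have hone : ((1 : ℝ) : ℂ) • X = X := by simp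
  have hev : ∀ᶠ s : ℝ in 𝓝 1, (s : ℂ) • X ∈ polyball H n := by
    have e1 : ∀ᶠ s : ℝ in 𝓝 1, ∀ i, ‖Phi (((s : ℂ) • X) i) 1‖ < 1 := by
      refine eventually_all.mpr fun i => ?_
      have hcont : Continuous fun s : ℝ => ‖Phi (((s : ℂ) • X) i) 1‖ := by
        simp only [Pi.smul_apply, Phi_smul, LinearMap.smul_apply]
        fun_prop
      have := hcont.tendsto 1
      rw [hone] at this
      exact this.eventually (gt_mem_nhds (h2 i))
    have e2 := eventually_isStrictlyPositive
      (continuous_partialDefect_smul X (List.finRange k) 1)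
      (fun s => isSelfAdjoint_partialDefect _ _ (IsSelfAdjoint.one _)) (s₀ := 1) (by rwa [hone])
    filter_upwards [e1, e2] with s hs1 hs2
    exact (mem_polyball_iff _).mpr ⟨commute_smul h1 _, hs1, hs2⟩
  obtain ⟨s, hs, hs1⟩ := ((hev.filter_mono nhdsWithin_le_nhds).and
    (self_mem_nhdsWithin : Set.Ioi (1 : ℝ) ∈ 𝓝[>] 1)).exists
  have hs1' : 1 < s := hs1
  refine ⟨s⁻¹, ⟨by positivity, inv_lt_one_of_one_lt₀ hs1'⟩, _, hs, ?_⟩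
  rw [smul_smul, ← Complex.ofReal_mul, inv_mul_cancel₀ (by positivity), hone]

end Defect

/-! ### Creation operators on the Fock space -/

section Fock

variable {k : ℕ} {n : Fin k → ℕ}

theorem inner_fockBasis_left (γ : MultiWord n) (f : Fock.{v} n) :
    ⟪fockBasis γ, f⟫_ℂ = f (ULift.up γ) := by
  simp [fockBasis, lp.inner_single_left]

theorem fockBasis_apply (γ τ : MultiWord n) :
    (fockBasis.{v} γ) (ULift.up τ) = if τ = γ then 1 else 0 := by
  rw [fockBasis, lp.coeFn_single, Pi.single_apply]
  simp only [ULift.up_inj]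

theorem Fock.ext {f g : Fock.{v} n} (h : ∀ γ, ⟪fockBasis γ, f⟫_ℂ = ⟪fockBasis γ, g⟫_ℂ) :
    f = g := by
  refine lp.ext (funext fun γ => ?_)
  simpa [inner_fockBasis_left] using h γ.down

theorem dense_span_fockBasis :
    Dense (Submodule.span ℂ (Set.range (fockBasis.{v} (n := n))) : Set (Fock.{v} n)) := by
  rw [Submodule.dense_iff_topologicalClosure_eq_top, Submodule.topologicalClosure_eq_top_iff,
    Submodule.eq_bot_iff]
  intro f hf
  refine Fock.ext fun γ => ?_
  rw [inner_zero_right]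
  exact (Submodule.mem_orthogonal _ f).mp hf _ (Submodule.subset_span ⟨γ, rfl⟩)

theorem creation_adjoint_consAt (i : Fin k) (j : Fin (n i)) (γ : MultiWord n) :
    ContinuousLinearMap.adjoint (creation.{v} i j) (fockBasis (consAt i j γ)) = fockBasis γ := by
  refine Fock.ext fun τ => ?_
  rw [ContinuousLinearMap.adjoint_inner_right, creation_fockBasis, inner_fockBasis_left,
    inner_fockBasis_left, fockBasis_apply, fockBasis_apply]
  simp only [(consAt_injective i j).eq_iff]

theorem creation_adjoint_of_notMem_range {i : Fin k} {j : Fin (n i)} {γ : MultiWord n}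
    (h : ∀ τ, consAt i j τ ≠ γ) :
    ContinuousLinearMap.adjoint (creation.{v} i j) (fockBasis γ) = 0 := by
  refine Fock.ext fun τ => ?_
  rw [ContinuousLinearMap.adjoint_inner_right, creation_fockBasis, inner_fockBasis_left,
    fockBasis_apply, if_neg (h τ), inner_zero_right]

/-- A diagonal operator with non-negative entries is positive. -/
theorem nonneg_of_diagonal {D : Fock.{v} n →L[ℂ] Fock.{v} n} {d : MultiWord n → ℝ}
    (hD : ∀ γ, D (fockBasis γ) = (d γ : ℂ) • fockBasis γ) (hd : ∀ γ, 0 ≤ d γ) : 0 ≤ D := by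
  rw [ContinuousLinearMap.nonneg_iff_isPositive]
  have hadj : ∀ γ, ContinuousLinearMap.adjoint D (fockBasis γ) = (d γ : ℂ) • fockBasis γ := by
    intro γ
    refine Fock.ext fun τ => ?_
    rw [ContinuousLinearMap.adjoint_inner_right, hD, inner_smul_left, inner_smul_right,
      inner_fockBasis_left, fockBasis_apply]
    split_ifs with h
    · simp [h]
    · simp
  refine (isPositive_iff_inner D).mpr fun f => ?_
  rw [lp.inner_eq_tsum]
  refine tsum_nonneg fun γ => ?_
  have : (D f) γ = (d γ.down : ℂ) * f γ := by
    rw [← inner_fockBasis_left γ.down (D f), ← ContinuousLinearMap.adjoint_inner_left, hadj,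
      inner_smul_left, inner_fockBasis_left, Complex.conj_ofReal]
  rw [this]
  change 0 ≤ ⟪f γ, ((d γ.down : ℝ) : ℂ) • f γ⟫_ℂ
  rw [inner_smul_right]
  refine mul_nonneg (by exact_mod_cast hd _) ?_
  rw [inner_self_eq_norm_sq_to_K, ← RCLike.ofReal_pow]
  exact Complex.zero_le_real.mpr (sq_nonneg ‖f γ‖)

theorem consAt_of_ne {i l : Fin k} (h : l ≠ i) (j : Fin (n i)) (γ : MultiWord n) :
    consAt i j γ l = γ l := by
  simp [consAt, h]

theorem consAt_self (i : Fin k) (j : Fin (n i)) (γ : MultiWord n) :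
    consAt i j γ i = j :: γ i := by
  simp [consAt]

theorem consAt_tail {i : Fin k} {j : Fin (n i)} {w : List (Fin (n i))} {γ : MultiWord n}
    (h : γ i = j :: w) : consAt i j (Function.update γ i w) = γ := by
  funext l
  rcases eq_or_ne l i with rfl | hl
  · simp [consAt, h]
  · simp [consAt, hl]

/-- `Φ_{S_i}` maps diagonal operators to diagonal operators. The entries are assumed not to depend
on the `i`-th word. -/
theorem Phi_universalModel_diagonal {D : Fock.{v} n →L[ℂ] Fock.{v} n} {d : MultiWord n → ℝ}
    (hD : ∀ γ, D (fockBasis γ) = (d γ : ℂ) • fockBasis γ) (i : Fin k)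
    (hd : ∀ j γ, d (consAt i j γ) = d γ) (γ : MultiWord n) :
    Phi (universalModel.{v} n i) D (fockBasis γ) =
      ((if γ i = [] then 0 else d γ : ℝ) : ℂ) • fockBasis γ := by
  rw [Phi_apply, sum_apply]
  simp only [mul_apply_eq_comp, ContinuousLinearMap.star_eq_adjoint, universalModel]
  rcases hγ : γ i with _ | ⟨a, w⟩
  · simp only [if_true, Complex.ofReal_zero, zero_smul]
    refine Finset.sum_eq_zero fun j _ => ?_
    rw [creation_adjoint_of_notMem_range, map_zero, map_zero]
    rintro τ rfl
    simp [consAt_self] at hγ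
  · rw [Finset.sum_eq_single a]
    · conv_lhs => rw [← consAt_tail hγ, creation_adjoint_consAt, hD, map_smul, creation_fockBasis]
      rw [← hd a, consAt_tail hγ]
      simp
    · intro j _ hj
      rw [creation_adjoint_of_notMem_range, map_zero, map_zero]
      rintro τ rfl
      rw [consAt_self] at hγ
      exact hj (List.cons.inj hγ).1
    · simp

theorem creation_commute {s t : Fin k} (h : s ≠ t) (a : Fin (n s)) (b : Fin (n t)) :
    Commute (creation.{v} s a) (creation.{v} t b) := by
  refine ContinuousLinearMap.ext_on dense_span_fockBasis ?_
  rintro _ ⟨γ, rfl⟩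
  rw [mul_apply_eq_comp, mul_apply_eq_comp, creation_fockBasis, creation_fockBasis,
    creation_fockBasis, creation_fockBasis]
  congr 1
  simp only [consAt, Function.update_of_ne h, Function.update_of_ne h.symm]
  rw [Function.update_comm h]

/-- The defect operators of `rS` are diagonal: each coordinate `i` contributes the factor `1 - r²` at
the basis vectors `e_γ` with `γ_i` non-empty. -/
theorem partialDefect_universalModel (r : ℝ) {l : List (Fin k)} (hl : l.Nodup) (γ : MultiWord n) :
    partialDefect ((r : ℂ) • universalModel.{v} n) l 1 (fockBasis γ) =
      (((l.map fun i => if γ i = [] then 1 else 1 - r ^ 2).prod : ℝ) : ℂ) • fockBasis γ := by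
  induction l generalizing γ with
  | nil => simp
  | cons i l ih =>
    obtain ⟨hi, hl⟩ := List.nodup_cons.mp hl
    have hd : ∀ (j : Fin (n i)) (γ : MultiWord n),
        (l.map fun i' => if consAt i j γ i' = [] then 1 else 1 - r ^ 2).prod =
          (l.map fun i' => if γ i' = [] then 1 else 1 - r ^ 2).prod := fun j γ => by
      congr 1
      refine List.map_congr_left fun i' hi' => ?_
      rw [consAt_of_ne]
      rintro rfl
      exact hi hi'
    rw [partialDefect_cons_apply, Pi.smul_apply, Phi_smul, LinearMap.smul_apply, sub_apply, ih hl,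
      smul_apply, Phi_universalModel_diagonal (ih hl) i hd, smul_smul, ← sub_smul, List.map_cons,
      List.prod_cons]
    congr 1
    split_ifs
    · push_cast; ring
    · push_cast; ring

/-- The proper dilates of the universal model lie in the polyball. -/
theorem smul_universalModel_mem_polyball {r : ℝ} (hr : r ∈ Set.Ico (0 : ℝ) 1) :
    (r : ℂ) • universalModel.{v} n ∈ polyball (Fock.{v} n) n := by
  have hr2 : r ^ 2 < 1 := by nlinarith [hr.1, hr.2]
  refine (mem_polyball_iff _).mpr ⟨?_, fun i => ?_, ?_⟩
  · exact commute_smul (fun s t hst a b => creation_commute hst a b) _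
  · have h1 : ∀ γ, (1 : Fock.{v} n →L[ℂ] Fock.{v} n) (fockBasis γ) =
        ((1 : ℝ) : ℂ) • fockBasis γ := fun γ => by simp
    have h2 := Phi_universalModel_diagonal h1 i fun _ _ => rfl
    have hle : ‖Phi (universalModel.{v} n i) 1‖ ≤ 1 := by
      refine norm_Phi_one_le_one ?_
      rw [← sub_nonneg]
      refine nonneg_of_diagonal (d := fun γ => 1 - if γ i = [] then 0 else 1) (fun γ => ?_)
        fun γ => ?_
      · rw [sub_apply, h2, h1, ← sub_smul]
        push_cast
        rfl
      · split_ifs <;> simp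
    rw [Pi.smul_apply, norm_Phi_smul]
    exact (mul_le_of_le_one_right (sq_nonneg r) hle).trans_lt hr2
  · set c : ℝ := (1 - r ^ 2) ^ k
    have hc : 0 < c := by
      have : 0 < 1 - r ^ 2 := by linarith
      positivity
    refine isStrictlyPositive_of_algebraMap_le hc (sub_nonneg.mp ?_)
    refine nonneg_of_diagonal (fun γ => ?_) (fun γ => ?_)
      (d := fun γ => ((List.finRange k).map fun i => if γ i = [] then 1 else 1 - r ^ 2).prod - c)
    · rw [sub_apply, partialDefect_universalModel r (List.nodup_finRange k),
        Algebra.algebraMap_eq_smul_one, smul_apply]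
      rw [Complex.ofReal_sub, sub_smul]
      rfl
    · rw [sub_nonneg]
      have : c = ((List.finRange k).map fun _ => 1 - r ^ 2).prod := by simp [c]
      rw [this]
      refine List.prod_map_le_prod_map₀ _ _ (fun i _ => by linarith) fun i _ => ?_
      split_ifs
      · nlinarith [sq_nonneg r]
      · exact le_rfl

end Fock

/-! ### Monomials -/

section WordProd

variable {k : ℕ} {n : Fin k → ℕ} {H : Type*} [NormedAddCommGroup H] [InnerProductSpace ℂ H]

/-- The product `X_{1,α_1} ⋯ X_{k,α_k}`. -/
def wordProd (X : OpTuple n H) (α : MultiWord n) : H →L[ℂ] H :=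
  (List.ofFn fun i => wordOp (X i) (α i)).prod

@[simp]
theorem wordOp_nil {d : ℕ} (T : Fin d → H →L[ℂ] H) : wordOp T [] = 1 := rfl

@[simp]
theorem wordOp_cons {d : ℕ} (T : Fin d → H →L[ℂ] H) (j : Fin d) (w : List (Fin d)) :
    wordOp T (j :: w) = T j * wordOp T w := by
  simp [wordOp]

theorem commute_wordOp {d : ℕ} {T : Fin d → H →L[ℂ] H} {R : H →L[ℂ] H}
    (h : ∀ j, Commute R (T j)) (w : List (Fin d)) : Commute R (wordOp T w) := by
  refine Commute.list_prod_right _ _ fun y hy => ?_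
  obtain ⟨j, -, rfl⟩ := List.mem_map.mp hy
  exact h j

theorem wordOp_smul {d : ℕ} (c : ℂ) (T : Fin d → H →L[ℂ] H) (w : List (Fin d)) :
    wordOp (c • T) w = c ^ w.length • wordOp T w := by
  induction w with
  | nil => simp
  | cons j w ih =>
    rw [wordOp_cons, ih, wordOp_cons, Pi.smul_apply, smul_mul_smul_comm, List.length_cons,
      pow_succ']

/-- The total length `|α_1| + ⋯ + |α_k|`. -/
def wordLength (α : MultiWord n) : ℕ := ∑ i, (α i).length

theorem wordProd_smul (c : ℂ) (X : OpTuple n H) (α : MultiWord n) :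
    wordProd (c • X) α = c ^ wordLength α • wordProd X α := by
  have key : ∀ l : List (Fin k), (l.map fun i => wordOp ((c • X) i) (α i)).prod =
      c ^ (l.map fun i => (α i).length).sum • (l.map fun i => wordOp (X i) (α i)).prod :=
    fun l => by
      induction l with
      | nil => simp
      | cons i l ih =>
        rw [List.map_cons, List.prod_cons, ih, Pi.smul_apply, wordOp_smul, smul_mul_smul_comm,
          List.map_cons, List.sum_cons, pow_add, List.map_cons, List.prod_cons]
  rw [wordProd, wordProd, List.ofFn_eq_map, List.ofFn_eq_map, key, wordLength,
    ← List.ofFn_eq_map, List.sum_ofFn]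

/-- The concatenation of multi-words. -/
def concat (α γ : MultiWord n) : MultiWord n := fun i => α i ++ γ i

theorem commute_list_prod_wordOp {X : OpTuple n H} {R : H →L[ℂ] H} {l : List (Fin k)}
    (h : ∀ i ∈ l, ∀ j, Commute R (X i j)) (γ : MultiWord n) :
    Commute R (l.map fun i => wordOp (X i) (γ i)).prod := by
  refine Commute.list_prod_right _ _ fun y hy => ?_
  obtain ⟨i, hi, rfl⟩ := List.mem_map.mp hy
  exact commute_wordOp (h i hi) _

theorem wordProd_consAt {X : OpTuple n H}
    (hX : ∀ s t : Fin k, s ≠ t → ∀ a b, Commute (X s a) (X t b)) (i : Fin k) (j : Fin (n i))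
    (γ : MultiWord n) : wordProd X (consAt i j γ) = X i j * wordProd X γ := by
  have key : ∀ l : List (Fin k), l.Nodup → i ∈ l →
      (l.map fun l => wordOp (X l) (consAt i j γ l)).prod =
        X i j * (l.map fun l => wordOp (X l) (γ l)).prod := fun l => by
    induction l with
    | nil => exact fun _ h => absurd h (by simp)
    | cons a l ih =>
      intro hl hi
      obtain ⟨ha, hl⟩ := List.nodup_cons.mp hl
      rw [List.map_cons, List.prod_cons, List.map_cons, List.prod_cons]
      rcases eq_or_ne a i with rfl | hai
      · rw [consAt_self, wordOp_cons, mul_assoc]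
        congr 3
        refine List.map_congr_left fun b hb => ?_
        rw [consAt_of_ne]
        rintro rfl
        exact ha hb
      · rw [ih hl ((List.mem_cons.mp hi).resolve_left hai.symm), consAt_of_ne hai, ← mul_assoc,
          ← mul_assoc, (commute_wordOp (fun b => hX i a hai.symm j b) (γ a)).eq]
  rw [wordProd, wordProd, List.ofFn_eq_map, List.ofFn_eq_map,
    key _ (List.nodup_finRange k) (List.mem_finRange i)]

/-- As the row tuples commute, the adjoint factors of a monomial may be collected into the adjoint
of `X_{1,β_1} ⋯ X_{k,β_k}`. -/
theorem monomial_eq [CompleteSpace H] {X : OpTuple n H}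
    (hX : ∀ s t : Fin k, s ≠ t → ∀ a b, Commute (X s a) (X t b)) (α β : MultiWord n) :
    monomial X α β = wordProd X α * star (wordProd X β) := by
  have key : ∀ l : List (Fin k), l.Nodup →
      (l.map fun i => star (wordOp (X i) (β i))).prod =
        star (l.map fun i => wordOp (X i) (β i)).prod := fun l => by
    induction l with
    | nil => simp
    | cons a l ih =>
      intro hl
      obtain ⟨ha, hl⟩ := List.nodup_cons.mp hl
      rw [List.map_cons, List.prod_cons, List.map_cons, List.prod_cons, ih hl, ← star_mul]
      congr 1
      refine (commute_list_prod_wordOp (fun i hi j => ?_) β).eq.symm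
      refine (commute_wordOp (fun b => hX i a ?_ j b) (β a)).symm
      rintro rfl
      exact ha hi
  rw [monomial, wordProd, wordProd, List.ofFn_eq_map (f := fun i => wordOp (X i) (β i)),
    ← key _ (List.nodup_finRange k), ← List.ofFn_eq_map]
  rfl

end WordProd

/-! ### Coefficient indices -/

section Index

variable {k : ℕ} {n : Fin k → ℕ}

/-- The multidegree `|β_i| - |α_i|` of an index `(α, β)`. -/
def CoeffIndex.degree (p : CoeffIndex n) : Fin k → ℤ :=
  fun i => ((p.1.2 i).length : ℤ) - ((p.1.1 i).length : ℤ)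

theorem CoeffIndex.degree_ofDegree (m : Fin k → ℤ) (a : ∀ i, Fin (-(m i)).toNat → Fin (n i))
    (b : ∀ i, Fin (m i).toNat → Fin (n i)) : (CoeffIndex.ofDegree m a b).degree = m := by
  funext i
  simp [CoeffIndex.degree, CoeffIndex.ofDegree]

theorem CoeffIndex.ofDegree_inj {m : Fin k → ℤ} {a a' : ∀ i, Fin (-(m i)).toNat → Fin (n i)}
    {b b' : ∀ i, Fin (m i).toNat → Fin (n i)}
    (h : CoeffIndex.ofDegree m a b = CoeffIndex.ofDegree m a' b') : a = a' ∧ b = b' := by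
  have h1 := congrArg (fun p : CoeffIndex n => p.1.1) h
  have h2 := congrArg (fun p : CoeffIndex n => p.1.2) h
  exact ⟨funext fun i => List.ofFn_injective (congrFun h1 i),
    funext fun i => List.ofFn_injective (congrFun h2 i)⟩

theorem CoeffIndex.exists_ofDegree (p : CoeffIndex n) :
    ∃ a b, CoeffIndex.ofDegree p.degree a b = p := by
  have aux : ∀ {d N : ℕ} (l : List (Fin d)), l.length = N →
      ∃ f : Fin N → Fin d, List.ofFn f = l := by
    rintro d _ l rfl
    exact ⟨l.get, List.ofFn_get l⟩
  have h1 : ∀ i, ∃ f : Fin (-(p.degree i)).toNat → Fin (n i), List.ofFn f = p.1.1 i := fun i => by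
    refine aux _ ?_
    rcases p.2 i with h | h <;> simp [CoeffIndex.degree, h]
  have h2 : ∀ i, ∃ f : Fin (p.degree i).toNat → Fin (n i), List.ofFn f = p.1.2 i := fun i => by
    refine aux _ ?_
    rcases p.2 i with h | h <;> simp [CoeffIndex.degree, h]
  choose a ha using h1
  choose b hb using h2
  exact ⟨a, b, Subtype.ext (Prod.ext (funext ha) (funext hb))⟩

/-- An index `p` occurs exactly once in its homogeneous component. -/
theorem sum_ofDegree_eq {M : Type*} [AddCommMonoid M] {g : CoeffIndex n → M} {p : CoeffIndex n}
    (hg : ∀ q, q ≠ p → g q = 0) :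
    ∑ a, ∑ b, g (CoeffIndex.ofDegree p.degree a b) = g p := by
  obtain ⟨a, b, hab⟩ := p.exists_ofDegree
  rw [Finset.sum_eq_single a, Finset.sum_eq_single b, hab]
  · exact fun b' _ hb' => hg _ fun h => hb' (CoeffIndex.ofDegree_inj (h.trans hab.symm)).2
  · simp
  · exact fun a' _ ha' => Finset.sum_eq_zero fun b' _ =>
      hg _ fun h => ha' (CoeffIndex.ofDegree_inj (h.trans hab.symm)).1
  · simp

/-- For two words `a, b`, one of which is empty, `g` and `w` arise from a common right factor by
prefixing `a` and `b` exactly if they are right comparable with left quotients `a` and `b`. -/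
theorem exists_append_iff {d : ℕ} {a b : List (Fin d)} (hab : a = [] ∨ b = [])
    (g w : List (Fin d)) :
    (∃ t, g = a ++ t ∧ w = b ++ t) ↔ RightComparable g w ∧ cPlus g w = a ∧ cPlus w g = b := by
  have hnil : ∀ s t : List (Fin d), cPlus t (s ++ t) = [] := fun s t => by
    unfold cPlus
    split_ifs
    · simp
    · rfl
  constructor
  · rintro ⟨t, rfl, rfl⟩
    rcases hab with rfl | rfl
    · exact ⟨Or.inr (List.suffix_append _ _), by simpa using hnil b t,
        by simpa using cPlus_append b t⟩
    · exact ⟨Or.inl (List.suffix_append _ _), by simpa using cPlus_append a t,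
        by simpa using hnil a t⟩
  · rintro ⟨⟨s, rfl⟩ | ⟨s, rfl⟩, rfl, rfl⟩
    · exact ⟨w, by rw [cPlus_append], by rw [hnil, List.nil_append]⟩
    · exact ⟨g, by rw [hnil, List.nil_append], by rw [cPlus_append]⟩

/-- The only index `(α, β)` with `γ = ατ` and `ω = βτ` for some `τ` is
`(c_r^+(γ, ω); c_r^-(γ, ω))`, and it has this property if `γ, ω` are right comparable. -/
theorem exists_concat_iff (p : CoeffIndex n) (γ ω : MultiWord n) :
    (∃ τ, γ = concat p.1.1 τ ∧ ω = concat p.1.2 τ) ↔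
      (∀ i, RightComparable (γ i) (ω i)) ∧ p = cIndex γ ω := by
  have h : ∀ i, (∃ t, γ i = p.1.1 i ++ t ∧ ω i = p.1.2 i ++ t) ↔ RightComparable (γ i) (ω i) ∧
      cPlus (γ i) (ω i) = p.1.1 i ∧ cPlus (ω i) (γ i) = p.1.2 i :=
    fun i => exists_append_iff (p.2 i) _ _
  constructor
  · rintro ⟨τ, rfl, rfl⟩
    have h' := fun i => (h i).mp ⟨τ i, rfl, rfl⟩
    exact ⟨fun i => (h' i).1, Subtype.ext (Prod.ext (funext fun i => (h' i).2.1.symm)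
      (funext fun i => (h' i).2.2.symm))⟩
  · rintro ⟨hc, rfl⟩
    choose τ h1 h2 using fun i => (h i).mpr ⟨hc i, rfl, rfl⟩
    exact ⟨τ, funext h1, funext h2⟩

end Index

/-! ### Matrix entries at the universal model -/

section Entries

variable {k : ℕ} {n : Fin k → ℕ}

theorem universalModel_commute (s t : Fin k) (h : s ≠ t) (a : Fin (n s)) (b : Fin (n t)) :
    Commute (universalModel.{v} n s a) (universalModel.{v} n t b) :=
  creation_commute h a b

theorem wordProd_universalModel (α γ : MultiWord n) :
    wordProd (universalModel.{v} n) α (fockBasis γ) = fockBasis (concat α γ) := by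
  have hword : ∀ (i : Fin k) (w : List (Fin (n i))) (γ : MultiWord n),
      wordOp (universalModel.{v} n i) w (fockBasis γ) =
        fockBasis (Function.update γ i (w ++ γ i)) := fun i w γ => by
    induction w with
    | nil => simp
    | cons j w ih =>
      rw [wordOp_cons, mul_apply_eq_comp, ih, universalModel, creation_fockBasis]
      simp [consAt]
  have key : ∀ l : List (Fin k), l.Nodup →
      (l.map fun i => wordOp (universalModel.{v} n i) (α i)).prod (fockBasis γ) =
        fockBasis fun i => if i ∈ l then α i ++ γ i else γ i := fun l => by
    induction l with
    | nil => simp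
    | cons a l ih =>
      intro hl
      obtain ⟨ha, hl⟩ := List.nodup_cons.mp hl
      rw [List.map_cons, List.prod_cons, mul_apply_eq_comp, ih hl, hword]
      congr 1
      funext i
      rcases eq_or_ne i a with rfl | hia
      · simp [ha]
      · simp [hia]
  rw [wordProd, List.ofFn_eq_map, key _ (List.nodup_finRange k)]
  simp only [List.mem_finRange, if_true]
  rfl

theorem concat_right_injective (α : MultiWord n) : Function.Injective (concat α) :=
  fun _ _ h => funext fun i => List.append_cancel_left (congrFun h i)

open Classical in
/-- The matrix of `S_α S_β^*` is the indicator function of the pairs `(γ, ω)` which have the index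
`(α, β)`. -/
theorem inner_monomial_universalModel (p : CoeffIndex n) (γ ω : MultiWord n) :
    ⟪fockBasis.{v} γ, monomial (universalModel n) p.1.1 p.1.2 (fockBasis ω)⟫_ℂ =
      if (∀ i, RightComparable (γ i) (ω i)) ∧ p = cIndex γ ω then 1 else 0 := by
  have hstar : ∀ β τ : MultiWord n,
      ⟪fockBasis.{v} τ, star (wordProd (universalModel n) β) (fockBasis ω)⟫_ℂ =
        if concat β τ = ω then 1 else 0 := fun β τ => by
    rw [ContinuousLinearMap.star_eq_adjoint, ContinuousLinearMap.adjoint_inner_right,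
      wordProd_universalModel, inner_fockBasis_left, fockBasis_apply]
  rw [monomial_eq universalModel_commute, mul_apply_eq_comp]
  simp only [← exists_concat_iff]
  by_cases hω : ∃ τ, concat p.1.2 τ = ω
  · obtain ⟨τ, rfl⟩ := hω
    have : star (wordProd (universalModel.{v} n) p.1.2) (fockBasis (concat p.1.2 τ)) =
        fockBasis τ := by
      refine Fock.ext fun τ' => ?_
      rw [hstar, inner_fockBasis_left, fockBasis_apply]
      simp only [(concat_right_injective p.1.2).eq_iff]
    rw [this, wordProd_universalModel, inner_fockBasis_left, fockBasis_apply]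
    refine if_congr ⟨fun h => ⟨τ, h, rfl⟩, ?_⟩ rfl rfl
    rintro ⟨τ', h1, h2⟩
    rw [h1, concat_right_injective _ h2]
  · have : star (wordProd (universalModel.{v} n) p.1.2) (fockBasis ω) = 0 := by
      refine Fock.ext fun τ' => ?_
      rw [hstar, if_neg fun h => hω ⟨τ', h⟩, inner_zero_right]
    rw [this, map_zero, inner_zero_right, if_neg]
    rintro ⟨τ, -, h⟩
    exact hω ⟨τ, h.symm⟩

variable {E : Type u} [NormedAddCommGroup E] [InnerProductSpace ℂ E]

/-- Evaluation of a sesquilinear form at two fixed vectors, as an additive map on operators. -/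
def entry {G : Type*} [NormedAddCommGroup G] [InnerProductSpace ℂ G] (u w : G) :
    (G →L[ℂ] G) →+ ℂ :=
  AddMonoidHom.mk' (fun T => ⟪u, T w⟫_ℂ) fun S T => by rw [add_apply, inner_add_right]

theorem entry_apply {G : Type*} [NormedAddCommGroup G] [InnerProductSpace ℂ G] (u w : G)
    (T : G →L[ℂ] G) : entry u w T = ⟪u, T w⟫_ℂ := rfl

theorem continuous_entry {G : Type*} [NormedAddCommGroup G] [InnerProductSpace ℂ G] (u w : G) :
    Continuous (entry u w) :=
  continuous_const.inner (ContinuousLinearMap.apply ℂ G w).continuous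

/-- If the series with coefficients `B` converges at the universal model, then the matrix of its sum
with respect to the basis `e_γ` is the kernel `Γ` of `B`: every entry of the matrix involves a single
coefficient. -/
theorem entry_of_hasIteratedSum {B : CoeffIndex n → E →L[ℂ] E}
    {T : HTensor E (Fock.{v} n) →L[ℂ] HTensor E (Fock.{v} n)}
    (h : HasIteratedSum (homTerm B (universalModel n)) T) (γ ω : MultiWord n) (x y : E) :
    ⟪tmulL y (fockBasis γ), T (tmulL x (fockBasis ω))⟫_ℂ = ⟪y, Gamma B γ ω x⟫_ℂ := by
  classical
  set g : CoeffIndex n → ℂ := fun p =>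
    if (∀ i, RightComparable (γ i) (ω i)) ∧ p = cIndex γ ω then ⟪y, B p x⟫_ℂ else 0 with hg
  have hterm : ∀ m, entry (tmulL y (fockBasis γ)) (tmulL x (fockBasis ω))
      (homTerm B (universalModel n) m) = ∑ a, ∑ b, g (CoeffIndex.ofDegree m a b) := fun m => by
    simp only [homTerm, map_sum, entry_apply, opTensor_tmulL, inner_tmulL,
      inner_monomial_universalModel, mul_ite, mul_one, mul_zero, hg]
  have hzero : ∀ q, q ≠ cIndex γ ω → g q = 0 := fun q hq => if_neg fun h => hq h.2
  have h1 : HasIteratedSum (fun m => ∑ a, ∑ b, g (CoeffIndex.ofDegree m a b))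
      (entry (tmulL y (fockBasis γ)) (tmulL x (fockBasis ω)) T) := by
    rw [← funext hterm]
    exact h.map _ (continuous_entry _ _)
  have h2 := hasIteratedSum_single (cIndex γ ω).degree
    (f := fun m => ∑ a, ∑ b, g (CoeffIndex.ofDegree m a b)) fun m hm =>
      Finset.sum_eq_zero fun a _ => Finset.sum_eq_zero fun b _ => hzero _ fun h => hm (by
        rw [← h, CoeffIndex.degree_ofDegree])
  rw [sum_ofDegree_eq hzero] at h2
  rw [← entry_apply, h1.unique h2, hg, Gamma]
  by_cases hc : ∀ i, RightComparable (γ i) (ω i)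
  · simp [hc]
  · simp [hc]

end Entries

/-! ### Coefficients of dilates and the associated kernels -/

section Scale

variable {k : ℕ} {n : Fin k → ℕ} {E : Type u} [NormedAddCommGroup E] [InnerProductSpace ℂ E]

/-- The coefficients `r ^ (|α| + |β|) A_{(α;β)}` of the dilate `F_r`. -/
def scaleCoeff (r : ℝ) (A : CoeffIndex n → E →L[ℂ] E) : CoeffIndex n → E →L[ℂ] E :=
  fun p => (r : ℂ) ^ (wordLength p.1.1 + wordLength p.1.2) • A p

theorem scaleCoeff_injective {r : ℝ} (hr : r ≠ 0) :
    Function.Injective (scaleCoeff (n := n) (E := E) r) := by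
  intro A B h
  funext p
  have hne : (r : ℂ) ^ (wordLength p.1.1 + wordLength p.1.2) ≠ 0 :=
    pow_ne_zero _ (by exact_mod_cast hr)
  exact smul_right_injective _ hne (congrFun h p)

theorem homTerm_smul {H : Type v} [NormedAddCommGroup H] [InnerProductSpace ℂ H] [CompleteSpace H]
    {X : OpTuple n H} (hX : ∀ s t : Fin k, s ≠ t → ∀ a b, Commute (X s a) (X t b)) (r : ℝ)
    (A : CoeffIndex n → E →L[ℂ] E) : homTerm A ((r : ℂ) • X) = homTerm (scaleCoeff r A) X := by
  funext m
  unfold homTerm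
  refine Finset.sum_congr rfl fun a _ => Finset.sum_congr rfl fun b _ => ?_
  rw [monomial_eq (commute_smul hX r), monomial_eq hX, wordProd_smul, wordProd_smul, star_smul,
    smul_mul_smul_comm, opTensor_smul_right, scaleCoeff, opTensor_smul_left, pow_add]
  congr 2
  simp

theorem hasRepresentation_dilate {F : OpFunction.{u, v} n E} {A : CoeffIndex n → E →L[ℂ] E}
    (hA : HasRepresentation F A) {r : ℝ} (hr : r ∈ Set.Ico (0 : ℝ) 1) :
    HasRepresentation (dilate r F) (scaleCoeff r A) := fun H _ _ _ X hX => by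
  rw [← homTerm_smul hX.1]
  exact hA H _ (smul_mem_polyball hX ⟨hr.1, hr.2.le⟩)

/-- Every coefficient occurs in the kernel, at the pair of words which index it. -/
theorem Gamma_eq (B : CoeffIndex n → E →L[ℂ] E) (p : CoeffIndex n) :
    Gamma B p.1.1 p.1.2 = B p := by
  obtain ⟨h1, h2⟩ := (exists_concat_iff p p.1.1 p.1.2).mp ⟨fun _ => [], by
    constructor <;> funext i <;> simp [concat]⟩
  rw [Gamma, if_pos h1, ← h2]

/-- The coefficients of a free `k`-pluriharmonic function are determined by its value at `S / 2`. -/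
theorem HasRepresentation.unique {F : OpFunction.{u, v} n E} {A B : CoeffIndex n → E →L[ℂ] E}
    (hA : HasRepresentation F A) (hB : HasRepresentation F B) : A = B := by
  have hmem := smul_universalModel_mem_polyball.{v} (n := n) (r := 1 / 2) ⟨by norm_num, by norm_num⟩
  have h1 := hA _ _ hmem
  have h2 := hB _ _ hmem
  rw [homTerm_smul universalModel_commute] at h1 h2
  refine scaleCoeff_injective (r := 1 / 2) (by norm_num) (funext fun p => ?_)
  refine ContinuousLinearMap.ext fun x => ext_inner_left ℂ fun y => ?_
  rw [← Gamma_eq (scaleCoeff (1 / 2) A), ← Gamma_eq (scaleCoeff (1 / 2) B),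
    ← entry_of_hasIteratedSum h1, ← entry_of_hasIteratedSum h2]

/-- The kernel `Γ` is the matrix of the sum of the series at the universal model, so both are positive
at the same time. -/
theorem isPositive_iff_isPSDKernel {B : CoeffIndex n → E →L[ℂ] E}
    {T : HTensor E (Fock.{v} n) →L[ℂ] HTensor E (Fock.{v} n)}
    (h : HasIteratedSum (homTerm B (universalModel n)) T) :
    T.IsPositive ↔ IsPSDKernel (Gamma B) := by
  have hsum : ∀ (m : ℕ) (x : Fin m → E) (σ : Fin m → MultiWord n),
      ∑ i, ∑ j, ⟪x i, Gamma B (σ i) (σ j) (x j)⟫_ℂ =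
        ⟪∑ i, tmulL (x i) (fockBasis (σ i)), T (∑ j, tmulL (x j) (fockBasis (σ j)))⟫_ℂ :=
    fun m x σ => by
      rw [map_sum, sum_inner]
      refine Finset.sum_congr rfl fun i _ => ?_
      rw [inner_sum]
      exact Finset.sum_congr rfl fun j _ => (entry_of_hasIteratedSum h _ _ _ _).symm
  constructor
  · intro hT m x σ
    rw [hsum]
    exact hT.inner_nonneg_right _
  · intro hK
    refine isPositive_of_dense (dense_span_tmulL dense_span_fockBasis) fun z hz => ?_
    obtain ⟨m, c, g, rfl⟩ := Submodule.mem_span_set'.mp hz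
    have hg : ∀ i, ∃ x σ, tmulL x (fockBasis σ) = (g i : HTensor E (Fock.{v} n)) := fun i => by
      obtain ⟨x, _, ⟨σ, rfl⟩, hx⟩ := (g i).2
      exact ⟨x, σ, hx⟩
    choose x σ hx using hg
    have : ∑ i, c i • (g i : HTensor E (Fock.{v} n)) =
        ∑ i, tmulL (c i • x i) (fockBasis (σ i)) :=
      Finset.sum_congr rfl fun i _ => by rw [← hx, map_smul, smul_apply]
    rw [this, ← hsum]
    exact hK m _ σ

end Scale

/-! ### Geometric series of row maps -/

section WordSums

variable {d : ℕ}

/-- The finite set of words of length less than `N`. -/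
def wordsLT (d : ℕ) : ℕ → Finset (List (Fin d))
  | 0 => ∅
  | N + 1 => insert [] ((Finset.univ ×ˢ wordsLT d N).image fun p => p.1 :: p.2)

theorem mem_wordsLT {N : ℕ} {w : List (Fin d)} : w ∈ wordsLT d N ↔ w.length < N := by
  induction N generalizing w with
  | zero => simp [wordsLT]
  | succ N ih =>
    rcases w with _ | ⟨j, w⟩
    · simp [wordsLT]
    · simp [wordsLT, ih]

variable {H : Type*} [NormedAddCommGroup H] [InnerProductSpace ℂ H] [CompleteSpace H]

theorem sum_wordsLT_succ (T : Fin d → H →L[ℂ] H) (N : ℕ) :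
    ∑ w ∈ wordsLT d (N + 1), conjOp (wordOp T w) =
      1 + Phi T * ∑ w ∈ wordsLT d N, conjOp (wordOp T w) := by
  rw [wordsLT, Finset.sum_insert (by simp), wordOp_nil, conjOp_one, Finset.sum_image]
  · rw [Finset.sum_product, Phi_eq_sum, Finset.sum_mul_sum]
    simp only [wordOp_cons, conjOp_mul]
  · rintro ⟨a, w⟩ _ ⟨b, w'⟩ _ h
    simpa using h

/-- The geometric series of `Φ_T`, written as a sum over words. -/
theorem sum_wordsLT_mul (T : Fin d → H →L[ℂ] H) (N : ℕ) :
    (∑ w ∈ wordsLT d N, conjOp (wordOp T w)) * (1 - Phi T) = 1 - Phi T ^ N := by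
  induction N with
  | zero => simp [wordsLT]
  | succ N ih =>
    rw [sum_wordsLT_succ, add_mul, mul_assoc, ih, pow_succ', one_mul, mul_sub, mul_one,
      sub_add_sub_cancel]

theorem commute_sum_wordsLT {T : Fin d → H →L[ℂ] H} {Ψ : Module.End ℂ (H →L[ℂ] H)}
    (h : Commute Ψ (Phi T)) (N : ℕ) :
    Commute Ψ (∑ w ∈ wordsLT d N, conjOp (wordOp T w)) := by
  induction N with
  | zero => simp [wordsLT]
  | succ N ih =>
    rw [sum_wordsLT_succ]
    exact (Commute.one_right _).add_right (h.mul_right ih)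

variable {k : ℕ} {n : Fin k → ℕ}

theorem conjOp_wordProd (X : OpTuple n H) (γ : MultiWord n) :
    conjOp (wordProd X γ) = (List.ofFn fun i => conjOp (wordOp (X i) (γ i))).prod := by
  have key : ∀ l : List (Fin k), conjOp (l.map fun i => wordOp (X i) (γ i)).prod =
      (l.map fun i => conjOp (wordOp (X i) (γ i))).prod := fun l => by
    induction l with
    | nil => exact conjOp_one
    | cons i l ih => rw [List.map_cons, List.prod_cons, conjOp_mul, ih, List.map_cons,
        List.prod_cons]
  rw [wordProd, List.ofFn_eq_map, key, List.ofFn_eq_map]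

/-- A sum over a box of multi-words is a product of sums over words. -/
theorem sum_piFinset_conjOp (X : OpTuple n H) (N : ℕ) :
    ∑ γ ∈ Fintype.piFinset fun i => wordsLT (n i) N, conjOp (wordProd X γ) =
      ((List.finRange k).map fun i => ∑ w ∈ wordsLT (n i) N, conjOp (wordOp (X i) w)).prod := by
  have := (MultilinearMap.mkPiAlgebraFin ℂ k (Module.End ℂ (H →L[ℂ] H))).map_sum_finset
    (fun i w => conjOp (wordOp (X i) w)) fun i => wordsLT (n i) N
  simp only [MultilinearMap.mkPiAlgebraFin_apply] at this
  rw [← List.ofFn_eq_map, this]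
  exact Finset.sum_congr rfl fun γ _ => conjOp_wordProd X γ

theorem list_prod_map_mul {ι M : Type*} [Monoid M] {f g : ι → M}
    (h : ∀ i j, Commute (f i) (g j)) (l : List ι) :
    (l.map f).prod * (l.map g).prod = (l.map fun i => f i * g i).prod := by
  induction l with
  | nil => simp
  | cons i l ih =>
    have hc : Commute (l.map f).prod (g i) := Commute.list_prod_left _ _ fun y hy => by
      obtain ⟨j, -, rfl⟩ := List.mem_map.mp hy
      exact h j i
    simp only [List.map_cons, List.prod_cons]
    rw [← ih, mul_assoc, ← mul_assoc _ (g i), hc.eq]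
    simp only [mul_assoc]

/-- The sum of `X_γ Δ_X(I) X_γ^*` over all `γ` with `|γ_i| < N` telescopes in each coordinate. -/
theorem sum_piFinset_defect {X : OpTuple n H}
    (hX : ∀ s t : Fin k, s ≠ t → ∀ a b, Commute (X s a) (X t b)) (N : ℕ) :
    ∑ γ ∈ Fintype.piFinset fun i => wordsLT (n i) N,
      wordProd X γ * defectMap X 1 * star (wordProd X γ) =
      ((List.finRange k).map fun i => 1 - Phi (X i) ^ N).prod 1 := by
  have hcomm := Phi_commute_of_commute hX
  have h1 : ∑ γ ∈ Fintype.piFinset fun i => wordsLT (n i) N,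
      wordProd X γ * defectMap X 1 * star (wordProd X γ) =
      (∑ γ ∈ Fintype.piFinset fun i => wordsLT (n i) N, conjOp (wordProd X γ))
        (defectMap X 1) := by
    rw [LinearMap.sum_apply]
    rfl
  rw [h1, sum_piFinset_conjOp, defectMap_eq, partialDefect, ← Module.End.mul_apply,
    list_prod_map_mul]
  · simp only [sum_wordsLT_mul]
  · exact fun i j => (commute_sum_wordsLT
      ((Commute.one_left _).sub_left (hcomm j i)) N).symm

theorem tendsto_prod_one_sub_pow {X : OpTuple n H} (hX : ∀ i, ‖Phi (X i) 1‖ < 1)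
    (l : List (Fin k)) :
    Tendsto (fun N => (l.map fun i => (1 : Module.End ℂ (H →L[ℂ] H)) - Phi (X i) ^ N).prod 1) atTop (𝓝 1) := by
  induction l with
  | nil => exact tendsto_const_nhds
  | cons i l ih =>
    simp only [List.map_cons, List.prod_cons, Module.End.mul_apply, LinearMap.sub_apply,
      Module.End.one_apply]
    have h0 : Tendsto (fun N => (Phi (X i) ^ N)
        ((l.map fun i => (1 : Module.End ℂ (H →L[ℂ] H)) - Phi (X i) ^ N).prod 1)) atTop (𝓝 0) := by
      refine squeeze_zero_norm (fun N => norm_Phi_pow_le _ _ N) ?_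
      simpa using (tendsto_pow_atTop_nhds_zero_of_lt_one (norm_nonneg _) (hX i)).mul ih.norm
    simpa using ih.sub h0

/-- `∑_γ X_γ Δ_X(I) X_γ^* = I` in the weak sense, with `Δ_X(I) = R^* R`. -/
theorem hasSum_norm_sq_defect {X : OpTuple n H} (hX : X ∈ polyball H n) {R : H →L[ℂ] H}
    (hR : defectMap X 1 = star R * R) (h : H) :
    HasSum (fun γ : MultiWord n => ‖R (star (wordProd X γ) h)‖ ^ 2) (‖h‖ ^ 2) := by
  set f : MultiWord n → ℝ := fun γ => ‖R (star (wordProd X γ) h)‖ ^ 2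
  set box : ℕ → Finset (MultiWord n) := fun N => Fintype.piFinset fun i => wordsLT (n i) N
  have hf : ∀ γ, 0 ≤ f γ := fun γ => sq_nonneg _
  have hbox : ∀ N, ∑ γ ∈ box N, f γ =
      RCLike.re ⟪h, ((List.finRange k).map fun i => 1 - Phi (X i) ^ N).prod 1 h⟫_ℂ := fun N => by
    rw [← sum_piFinset_defect hX.1, hR, sum_apply, inner_sum, map_sum]
    refine Finset.sum_congr rfl fun γ _ => ?_
    have : wordProd X γ * (star R * R) * star (wordProd X γ) =
        star (R * star (wordProd X γ)) * (R * star (wordProd X γ)) := by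
      simp only [star_mul, star_star, mul_assoc]
    rw [this, mul_apply_eq_comp, ContinuousLinearMap.star_eq_adjoint,
      ContinuousLinearMap.adjoint_inner_right, inner_self_eq_norm_sq]
    rfl
  have hlim : Tendsto (fun N => ∑ γ ∈ box N, f γ) atTop (𝓝 (‖h‖ ^ 2)) := by
    have h2 : ∀ i, ‖Phi (X i) 1‖ < 1 := ((mem_polyball_iff X).mp hX).2.1
    have hc := (RCLike.continuous_re.comp (continuous_entry h h)).continuousAt.tendsto.comp
      (tendsto_prod_one_sub_pow h2 (List.finRange k))
    have h1 : (RCLike.re ∘ entry h h) 1 = ‖h‖ ^ 2 := inner_self_eq_norm_sq (𝕜 := ℂ) h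
    rw [h1] at hc
    exact hc.congr fun N => (hbox N).symm
  have hmono : Monotone box := fun M N hMN γ hγ => by
    simp only [box, Fintype.mem_piFinset, mem_wordsLT] at hγ ⊢
    exact fun i => (hγ i).trans_le hMN
  have hmonos : Monotone fun N => ∑ γ ∈ box N, f γ := fun M N hMN =>
    Finset.sum_le_sum_of_subset_of_nonneg (hmono hMN) fun γ _ _ => hf γ
  refine hasSum_of_isLUB_of_nonneg _ hf ⟨?_, ?_⟩
  · rintro _ ⟨s, rfl⟩
    obtain ⟨N, hN⟩ : ∃ N, s ⊆ box N := by
      refine ⟨(s.sup fun γ => wordLength γ) + 1, fun γ hγ => ?_⟩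
      simp only [box, Fintype.mem_piFinset, mem_wordsLT]
      intro i
      refine Nat.lt_succ_of_le (le_trans ?_ (Finset.le_sup (f := fun γ => wordLength γ) hγ))
      exact Finset.single_le_sum (f := fun i => (γ i).length) (fun _ _ => Nat.zero_le _)
        (Finset.mem_univ i)
    exact (Finset.sum_le_sum_of_subset_of_nonneg hN fun γ _ _ => hf γ).trans
      (hmonos.ge_of_tendsto hlim N)
  · intro b hb
    exact le_of_tendsto' hlim fun N => hb ⟨box N, rfl⟩

end WordSums

/-! ### The Poisson kernel and the Poisson transform -/

section Poisson

variable {k : ℕ} {n : Fin k → ℕ} {H : Type*} [NormedAddCommGroup H] [InnerProductSpace ℂ H]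

/-- The isometries `h ↦ e_γ ⊗ h`. -/
def fockTensor (H : Type*) [NormedAddCommGroup H] [InnerProductSpace ℂ H] (γ : MultiWord n) :
    H →ₗᵢ[ℂ] HTensor (Fock.{v} n) H where
  toLinearMap := (tmulL (fockBasis γ)).toLinearMap
  norm_map' h := by
    have h1 : ‖fockBasis.{v} γ‖ = 1 := (orthonormal_fockBasis n).1 (ULift.up γ)
    change ‖tmulL (fockBasis γ) h‖ = ‖h‖
    rw [tmulL_apply, UniformSpace.Completion.norm_coe, TensorProduct.norm_tmul, h1, one_mul]

theorem fockTensor_apply (γ : MultiWord n) (h : H) :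
    fockTensor.{v} H γ h = tmulL (fockBasis γ) h := rfl

theorem orthogonalFamily_fockTensor :
    OrthogonalFamily ℂ (fun _ : MultiWord n => H) (fockTensor.{v} H) := by
  intro γ τ hγτ x y
  rw [fockTensor_apply, fockTensor_apply, inner_tmulL, inner_fockBasis_left, fockBasis_apply,
    if_neg hγτ, zero_mul]

variable [CompleteSpace H]

/-- The Poisson kernel `h ↦ ∑_γ e_γ ⊗ Δ_X(I)^{1/2} X_γ^* h` of a point of the polyball: an isometry
which intertwines `X_{i,j}^*` with `S_{i,j}^* ⊗ I`. -/
theorem exists_poissonKernel {X : OpTuple n H} (hX : X ∈ polyball H n) :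
    ∃ K : H →ₗᵢ[ℂ] HTensor (Fock.{v} n) H, ∀ i j h,
      opTensor (star (universalModel n i j)) 1 (K h) = K (star (X i j) h) := by
  obtain ⟨R, hR⟩ := CStarAlgebra.nonneg_iff_eq_star_mul_self.mp hX.2.2.nonneg
  have hsum := hasSum_norm_sq_defect hX hR
  have hmem : ∀ h, Memℓp (fun γ : MultiWord n => R (star (wordProd X γ) h)) 2 := fun h => by
    refine memℓp_gen ?_
    simpa using (hsum h).summable
  let K₀ : H →ₗᵢ[ℂ] lp (fun _ : MultiWord n => H) 2 :=
    { toFun := fun h => ⟨fun γ => R (star (wordProd X γ) h), hmem h⟩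
      map_add' := fun a b => lp.ext (funext fun γ => by
        change R (star (wordProd X γ) (a + b)) = _ + _
        rw [map_add, map_add])
      map_smul' := fun c a => lp.ext (funext fun γ => by
        change R (star (wordProd X γ) (c • a)) = c • _
        rw [map_smul, map_smul])
      norm_map' := fun h => by
        have h1 := lp.hasSum_norm (p := 2) (by norm_num) (E := fun _ : MultiWord n => H)
          ⟨fun γ => R (star (wordProd X γ) h), hmem h⟩
        simp only [ENNReal.toReal_ofNat, Real.rpow_ofNat] at h1
        exact (pow_left_inj₀ (norm_nonneg _) (norm_nonneg _) two_ne_zero).mp (h1.unique (hsum h)) }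
  refine ⟨orthogonalFamily_fockTensor.linearIsometry.comp K₀, fun i j h => ?_⟩
  have hK : ∀ h, HasSum (fun γ => tmulL (fockBasis γ) (R (star (wordProd X γ) h)))
      (orthogonalFamily_fockTensor.{v}.linearIsometry (K₀ h)) :=
    fun h => orthogonalFamily_fockTensor.hasSum_linearIsometry (K₀ h)
  have h1 := (opTensor (star (universalModel n i j)) 1).hasSum (hK h)
  -- `S_{i,j}^* e_γ` vanishes unless `γ` begins with `g_j` in its `i`-th word
  rw [← (consAt_injective i j).hasSum_iff] at h1
  · refine h1.unique ?_
    convert! hK (star (X i j) h) using 2 with γ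
    rw [Function.comp_apply, opTensor_tmulL, one_apply_eq_self, universalModel,
      ContinuousLinearMap.star_eq_adjoint, creation_adjoint_consAt, wordProd_consAt hX.1, star_mul,
      mul_apply_eq_comp]
  · intro γ hγ
    rw [opTensor_tmulL, universalModel, ContinuousLinearMap.star_eq_adjoint,
      creation_adjoint_of_notMem_range fun τ h => hγ ⟨τ, h⟩, map_zero, zero_apply]

/-- The intertwining relation of a Poisson kernel passes from generators to words. -/
theorem poissonKernel_wordProd {X : OpTuple n H} {K : H →ₗᵢ[ℂ] HTensor (Fock.{v} n) H}
    (hK : ∀ i j h, opTensor (star (universalModel n i j)) 1 (K h) = K (star (X i j) h))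
    (α : MultiWord n) (h : H) :
    opTensor (star (wordProd (universalModel n) α)) 1 (K h) = K (star (wordProd X α) h) := by
  have hmul : ∀ (P P' : Fock.{v} n →L[ℂ] Fock.{v} n) (Q Q' : H →L[ℂ] H),
      (∀ h, opTensor (star P) 1 (K h) = K (star Q h)) →
      (∀ h, opTensor (star P') 1 (K h) = K (star Q' h)) →
      ∀ h, opTensor (star (P * P')) 1 (K h) = K (star (Q * Q') h) := fun P P' Q Q' h1 h2 h => by
    rw [star_mul, star_mul, ← mul_one (1 : H →L[ℂ] H), opTensor_mul, mul_apply_eq_comp, h1, h2,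
      mul_apply_eq_comp]
  have hone : ∀ h, opTensor (star (1 : Fock.{v} n →L[ℂ] Fock.{v} n)) 1 (K h) =
      K (star (1 : H →L[ℂ] H) h) := fun h => by
    have : opTensor (1 : Fock.{v} n →L[ℂ] Fock.{v} n) (1 : H →L[ℂ] H) = 1 :=
      HTensor.clm_ext fun x y => by simp
    rw [star_one, star_one, this]
    rfl
  have hword : ∀ (i : Fin k) (w : List (Fin (n i))) (h : H),
      opTensor (star (wordOp (universalModel n i) w)) 1 (K h) = K (star (wordOp (X i) w) h) :=
    fun i w => by
      induction w with
      | nil => exact hone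
      | cons j w ih => exact hmul _ _ _ _ (hK i j) ih
  have key : ∀ (l : List (Fin k)) (h : H),
      opTensor (star (l.map fun i => wordOp (universalModel n i) (α i)).prod) 1 (K h) =
        K (star (l.map fun i => wordOp (X i) (α i)).prod h) := fun l => by
    induction l with
    | nil => exact hone
    | cons i l ih => exact hmul _ _ _ _ (hword i _) ih
  rw [wordProd, wordProd, List.ofFn_eq_map, List.ofFn_eq_map]
  exact key _ h

/-- `K^* (S_α S_β^* ⊗ I) K = X_α X_β^*` for a Poisson kernel `K`. -/
theorem inner_poissonKernel {X : OpTuple n H}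
    (hX : ∀ s t : Fin k, s ≠ t → ∀ a b, Commute (X s a) (X t b))
    {K : H →ₗᵢ[ℂ] HTensor (Fock.{v} n) H}
    (hK : ∀ i j h, opTensor (star (universalModel n i j)) 1 (K h) = K (star (X i j) h))
    (α β : MultiWord n) (g h : H) :
    ⟪K g, opTensor (monomial (universalModel n) α β) 1 (K h)⟫_ℂ = ⟪g, monomial X α β h⟫_ℂ := by
  rw [monomial_eq hX, monomial_eq universalModel_commute, ← mul_one (1 : H →L[ℂ] H),
    opTensor_mul, mul_apply_eq_comp, mul_apply_eq_comp, poissonKernel_wordProd hK,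
    ← ContinuousLinearMap.adjoint_inner_left, adjoint_opTensor,
    ← ContinuousLinearMap.adjoint_inner_left, ← ContinuousLinearMap.star_eq_adjoint,
    ← ContinuousLinearMap.star_eq_adjoint, ← ContinuousLinearMap.star_eq_adjoint, star_one,
    poissonKernel_wordProd hK, K.inner_map_map]

end Poisson

section Insert

variable {E F H : Type*} [NormedAddCommGroup E] [InnerProductSpace ℂ E] [NormedAddCommGroup F]
  [InnerProductSpace ℂ F] [NormedAddCommGroup H] [InnerProductSpace ℂ H]

/-- The operator `f ⊗ h ↦ (x ⊗ f) ⊗ h`. -/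
def insertLeft (H : Type*) [NormedAddCommGroup H] [InnerProductSpace ℂ H] (x : E) :
    HTensor F H →L[ℂ] HTensor (HTensor E F) H :=
  (TensorProduct.mapL (tmulL x : F →L[ℂ] HTensor E F) (1 : H →L[ℂ] H)).completion

@[simp]
theorem insertLeft_tmulL (x : E) (f : F) (h : H) :
    insertLeft H x (tmulL f h) = tmulL (tmulL x f) h := by
  rw [insertLeft, tmulL_apply, ContinuousLinearMap.completion_apply_coe, TensorProduct.mapL_tmul]
  rfl

theorem opTensor_insertLeft (A : E →L[ℂ] E) (P : F →L[ℂ] F) (x : E) (z : HTensor F H) :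
    opTensor (opTensor A P) 1 (insertLeft H x z) = insertLeft H (A x) (opTensor P 1 z) := by
  have : (opTensor (opTensor A P) 1).comp (insertLeft H x) =
      (insertLeft H (A x)).comp (opTensor P 1) :=
    HTensor.clm_ext fun f h => by simp
  exact congrArg (fun T => T z) this

theorem inner_insertLeft [CompleteSpace E] [CompleteSpace F] [CompleteSpace H] (x y : E)
    (z w : HTensor F H) :
    ⟪insertLeft H x z, insertLeft H y w⟫_ℂ = ⟪x, y⟫_ℂ * ⟪z, w⟫_ℂ := by
  have h1 : ∀ f h, innerSL ℂ (ContinuousLinearMap.adjoint (insertLeft H y)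
      (insertLeft H x (tmulL f h))) = innerSL ℂ (⟪y, x⟫_ℂ • tmulL (H := H) (E := F) f h) :=
    fun f h => HTensor.clm_ext fun f' h' => by
      rw [innerSL_apply_apply, innerSL_apply_apply, ContinuousLinearMap.adjoint_inner_left,
        insertLeft_tmulL, insertLeft_tmulL, inner_tmulL, inner_tmulL, inner_smul_left, inner_tmulL,
        inner_conj_symm, mul_assoc]
  have h2 : (ContinuousLinearMap.adjoint (insertLeft H y)).comp (insertLeft (F := F) H x) =
      ⟪y, x⟫_ℂ • ContinuousLinearMap.id ℂ (HTensor F H) := HTensor.clm_ext fun f h =>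
    ext_inner_right ℂ fun v => congrArg (fun T => T v) (h1 f h)
  have h3 := congrArg (fun T : HTensor F H →L[ℂ] HTensor F H => ⟪T z, w⟫_ℂ) h2
  simpa [ContinuousLinearMap.adjoint_inner_left, inner_smul_left] using h3

end Insert

section PoissonTransform

variable {k : ℕ} {n : Fin k → ℕ} {E : Type u} [NormedAddCommGroup E] [InnerProductSpace ℂ E]
  [CompleteSpace E]

/-- Positivity passes through the Poisson transform: a series with coefficients `B` which is positive at the universal model
is positive at every point of the polyball. -/
theorem isPositive_of_universalModel {H : Type v} [NormedAddCommGroup H] [InnerProductSpace ℂ H]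
    [CompleteSpace H] {X : OpTuple n H} (hX : X ∈ polyball H n) {B : CoeffIndex n → E →L[ℂ] E}
    {T : HTensor E H →L[ℂ] HTensor E H} (hT : HasIteratedSum (homTerm B X) T)
    {T' : HTensor E (Fock.{v} n) →L[ℂ] HTensor E (Fock.{v} n)}
    (hT' : HasIteratedSum (homTerm B (universalModel n)) T') (hpos : T'.IsPositive) :
    T.IsPositive := by
  obtain ⟨K, hK⟩ := exists_poissonKernel.{v} hX
  refine isPositive_of_dense dense_span_range_tmulL fun z hz => ?_
  obtain ⟨m, c, g, rfl⟩ := Submodule.mem_span_set'.mp hz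
  choose x h hx using fun i => (g i).2
  have hz' : ∑ i, c i • (g i : HTensor E H) = ∑ i, tmulL (c i • x i) (h i) :=
    Finset.sum_congr rfl fun i _ => by rw [← hx, map_smul, smul_apply]
  rw [hz']
  set ξ := ∑ i, tmulL (c i • x i) (h i) with hξ
  -- `η` is `(I ⊗ K) ξ`, with the tensor factors in the order of `(E ⊗ Fock) ⊗ H`
  set η := ∑ i, insertLeft H (c i • x i) (K (h i)) with hη
  have hmono : ∀ (A : E →L[ℂ] E) (α β : MultiWord n),
      ⟪ξ, opTensor A (monomial X α β) ξ⟫_ℂ =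
        ⟪η, opTensor (opTensor A (monomial (universalModel n) α β)) 1 η⟫_ℂ := fun A α β => by
    rw [hξ, hη]
    simp only [map_sum, sum_inner, inner_sum, opTensor_tmulL, inner_tmulL, opTensor_insertLeft,
      inner_insertLeft, inner_poissonKernel hX.1 hK]
  set φ : (HTensor E (Fock.{v} n) →L[ℂ] HTensor E (Fock.{v} n)) →+ ℂ :=
    (entry η η).comp (ampliation 1)
  have hφ : Continuous φ := (continuous_entry η η).comp (continuous_ampliation 1)
  have h1 := hT.map _ (continuous_entry ξ ξ)
  have h2 := hT'.map φ hφ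
  have hterm : ∀ m, entry ξ ξ (homTerm B X m) = φ (homTerm B (universalModel n) m) := fun m => by
    rw [homTerm, homTerm]
    simp only [map_sum]
    exact Finset.sum_congr rfl fun a _ => Finset.sum_congr rfl fun b _ => hmono _ _ _
  rw [← funext hterm] at h2
  rw [← entry_apply, h1.unique h2]
  exact (isPositive_opTensor_one hpos).inner_nonneg_right η

end PoissonTransform

end

end FreePolyball

theorem mainTheorem6 {k : ℕ} (n : Fin k → ℕ) {E : Type u} [NormedAddCommGroup E]
    [InnerProductSpace ℂ E] [CompleteSpace E]
    (F : FreePolyball.OpFunction.{u, v} n E) (hF : FreePolyball.IsFreePluriharmonic F) :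
    (∀ r ∈ Set.Ico (0 : ℝ) 1,
      ∃! B : FreePolyball.CoeffIndex n → E →L[ℂ] E,
        FreePolyball.HasRepresentation (FreePolyball.dilate r F) B) ∧
    (FreePolyball.IsPositiveOnPolyball F ↔
      ∀ r ∈ Set.Ico (0 : ℝ) 1, ∀ B : FreePolyball.CoeffIndex n → E →L[ℂ] E,
        FreePolyball.HasRepresentation (FreePolyball.dilate r F) B →
          FreePolyball.IsPSDKernel (FreePolyball.Gamma B)) ∧
    (FreePolyball.IsPositiveOnPolyball F ↔
      ∀ r ∈ Set.Ico (0 : ℝ) 1,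
        (F (FreePolyball.Fock.{v} n)
          ((r : ℂ) • FreePolyball.universalModel.{v} n)).IsPositive) := by
  obtain ⟨A, hA⟩ := hF
  have hrep := fun r hr => FreePolyball.hasRepresentation_dilate hA (r := r) hr
  have hmodel : ∀ r ∈ Set.Ico (0 : ℝ) 1, FreePolyball.HasIteratedSum
      (FreePolyball.homTerm (FreePolyball.scaleCoeff r A) (FreePolyball.universalModel.{v} n))
      (F (FreePolyball.Fock.{v} n) ((r : ℂ) • FreePolyball.universalModel.{v} n)) := fun r hr => by
    rw [← FreePolyball.homTerm_smul FreePolyball.universalModel_commute]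
    exact hA _ _ (FreePolyball.smul_universalModel_mem_polyball hr)
  have h13 : FreePolyball.IsPositiveOnPolyball F ↔ ∀ r ∈ Set.Ico (0 : ℝ) 1,
      (F (FreePolyball.Fock.{v} n)
        ((r : ℂ) • FreePolyball.universalModel.{v} n)).IsPositive := by
    refine ⟨fun h r hr => h _ _ (FreePolyball.smul_universalModel_mem_polyball hr), ?_⟩
    intro h H _ _ _ X hX
    -- `X = tY` with `Y` in the polyball, so that `F(X)` is the Poisson transform at `Y` of `F(tS)`
    obtain ⟨t, ht, Y, hY, rfl⟩ := FreePolyball.exists_eq_smul_of_mem_polyball hX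
    have ht' : t ∈ Set.Ico (0 : ℝ) 1 := ⟨ht.1.le, ht.2⟩
    have hsum := hA H _ hX
    rw [FreePolyball.homTerm_smul hY.1] at hsum
    exact FreePolyball.isPositive_of_universalModel hY hsum (hmodel t ht') (h t ht')
  refine ⟨fun r hr => ⟨_, hrep r hr, fun B hB => hB.unique (hrep r hr)⟩, ?_, h13⟩
  rw [h13]
  refine forall₂_congr fun r hr => ?_
  rw [FreePolyball.isPositive_iff_isPSDKernel (hmodel r hr)]
  exact ⟨fun h B hB => hB.unique (hrep r hr) ▸ h, fun h => h _ (hrep r hr)⟩
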